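/- Let $n\ge 0$ be an integer and $\hbar>0$. On $L^2(\mathbb R^n)$ let $P_i=\frac12\left(-\hbar^2\partial_{x_i}^2+x_i^2\right)$, $1\le i\le n$, be the harmonic oscillators (the self-adjoint closures from the Schwartz functions; they commute), and for $h:\mathbb R^n\to\mathbb C$ which is either in the Schwartz class or a polynomial function let $h(P)=h(P_1,\dots,P_n)$ be the operator defined by the spectral theorem, i.e. $h(P)=\int h\,dE$ where $E$ is the joint spectral measure of $P_1,\dots,P_n$. A Weyl symbol of $h(P)$ is a continuous function $a$ of at most polynomial growth on $\mathbb R^n\times\mathbb R^n$ such that, for all Schwartz functions $u,v$, $u$ is in the domain of $h(P)$ and $$\langle v,h(P)u\rangle=\iint a(x,\xi)\,W(u,v)(x,\xi)\,dx\,d\xi,\qquad W(u,v)(x,\xi)=(2\pi\hbar)^{-n}\int_{\mathbb R^n} e^{-iy\cdot\xi/\hbar}\,u\!\left(x+\tfrac y2\right)\overline{v\!\left(x-\tfrac y2\right)}\,dy$$ (that is, $h(P)u=\mathrm{Op}^{W}_\hbar(a)u$ in the weak sense). Then $h(P)$ has exactly one Weyl symbol; it is of the form $a(x,\xi)=h^{we}(p_1,\dots,p_n)$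 with $p_i=\frac{x_i^2+\xi_i^2}2$; and the function $h^{we}:[0,\infty)^n\to\mathbb C$ depends only on the values $h\left((k+\frac12)\hbar\right)=h\left((k_1+\frac12)\hbar,\dots,(k_n+\frac12)\hbar\right)$, $k\in\mathbb N^n$ (with $0\in\mathbb N$). In other words, for fixed $n$ and $\hbar$ there is a map $F$ such that $h^{we}=F\left(\left(h((k+\frac12)\hbar)\right)_{k\in\mathbb N^n}\right)$ for every such $h$. -/

import Mathlib

open MeasureTheory
open scoped SchwartzMap LineDeriv NNReal ENNReal InnerProductSpace ComplexConjugate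

noncomputable section

namespace WeylOscillator

/-- `ℝⁿ` with its Euclidean structure. -/
abbrev Space (n : ℕ) : Type := EuclideanSpace ℝ (Fin n)

/-- The Hilbert space `L²(ℝⁿ; ℂ)`. -/
abbrev L2 (n : ℕ) : Type := Lp ℂ 2 (volume : Measure (Space n))

/-! ### Projection-valued measures and their functional calculus -/

/-- A projection-valued (spectral) measure on the measurable space `X`, acting on the Hilbert
space `H`: orthogonal projections, normalized, multiplicative and strongly countably additive.
(The values on non-measurable sets play no role.) -/
structure SpectralMeasure (X : Type*) [MeasurableSpace X]
    (H : Type*) [NormedAddCommGroup H] [InnerProductSpace ℂ H] [CompleteSpace H] where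
  /-- the projection attached to a set -/
  proj : Set X → H →L[ℂ] H
  isStarProjection : ∀ B, MeasurableSet B → IsStarProjection (proj B)
  proj_univ : proj Set.univ = 1
  proj_inter : ∀ A B, MeasurableSet A → MeasurableSet B → proj (A ∩ B) = proj A * proj B
  hasSum_proj : ∀ B : ℕ → Set X, (∀ i, MeasurableSet (B i)) →
    Pairwise (Function.onFun Disjoint B) →
      ∀ x : H, HasSum (fun i => proj (B i) x) (proj (⋃ i, B i) x)

namespace SpectralMeasure

variable {X : Type*} [MeasurableSpace X]
  {H : Type*} [NormedAddCommGroup H] [InnerProductSpace ℂ H] [CompleteSpace H]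

theorem inner_proj_nonneg (E : SpectralMeasure X H) {B : Set X} (hB : MeasurableSet B) (x : H) :
    0 ≤ (inner ℂ x (E.proj B x)).re := by
  have hp := E.isStarProjection B hB
  have h1 : E.proj B (E.proj B x) = E.proj B x :=
    congrArg (fun T : H →L[ℂ] H => T x) hp.isIdempotentElem
  have h2 : inner ℂ (E.proj B x) (E.proj B x) = inner ℂ x (E.proj B x) := by
    have h3 := ContinuousLinearMap.adjoint_inner_left (E.proj B) (E.proj B x) x
    rw [← ContinuousLinearMap.star_eq_adjoint, hp.isSelfAdjoint.star_eq, h1] at h3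
    exact h3
  rw [← h2]
  exact inner_self_nonneg (𝕜 := ℂ)

/-- The scalar spectral measure `B ↦ ⟨x, E(B) x⟩` of the vector `x`. -/
def diag (E : SpectralMeasure X H) (x : H) : Measure X :=
  Measure.ofMeasurable (fun B _ => ENNReal.ofReal (inner ℂ x (E.proj B x)).re)
    (by
      have h := (E.hasSum_proj (fun _ => ∅) (fun _ => MeasurableSet.empty)
        (fun _ _ _ => by simp [Function.onFun]) x).summable
      have h0 : E.proj ∅ x = 0 := tendsto_nhds_unique tendsto_const_nhds h.tendsto_atTop_zero
      simp [h0])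
    (by
      intro B hB hd
      have h := E.hasSum_proj B hB hd x
      have h1 : HasSum (fun i => (inner ℂ x (E.proj (B i) x)).re)
          (inner ℂ x (E.proj (⋃ i, B i) x)).re :=
        (h.mapL (innerSL ℂ x)).mapL Complex.reCLM
      rw [← h1.tsum_eq]
      exact ENNReal.ofReal_tsum_of_nonneg (fun i => E.inner_proj_nonneg (hB i) x) h1.summable)

/-- The complex number `⟨z, (∫ f dE) x⟩`, obtained by polarization from
`⟨w, (∫ f dE) w⟩ = ∫ f d⟨w, E w⟩` (the inner product is conjugate-linear in `z`). -/
def sesq (E : SpectralMeasure X H) (f : X → ℂ) (z x : H) : ℂ :=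
  ((∫ t, f t ∂(E.diag (z + x))) - (∫ t, f t ∂(E.diag (z - x)))
    + ((∫ t, f t ∂(E.diag (z - Complex.I • x))) - (∫ t, f t ∂(E.diag (z + Complex.I • x))))
      * Complex.I) / 4

/-- The graph of the (in general unbounded) operator `∫ f dE`: the vector `x` belongs to its
domain `{x | ∫ |f|² d⟨x, E x⟩ < ∞}` and `(∫ f dE) x = y`. The vector `y` is tested against the
vectors of the domain, which are dense. -/
def HasIntegral (E : SpectralMeasure X H) (f : X → ℂ) (x y : H) : Prop :=
  MemLp f 2 (E.diag x) ∧ ∀ z : H, MemLp f 2 (E.diag z) → inner ℂ z y = E.sesq f z x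

end SpectralMeasure

/-! ### The harmonic oscillators and their functions -/

/-- The harmonic oscillator `P_i = (-ħ² ∂²/∂x_i² + x_i²) / 2` on Schwartz functions. -/
def oscillator {n : ℕ} (ħ : ℝ) (i : Fin n) (u : 𝓢(Space n, ℂ)) : 𝓢(Space n, ℂ) :=
  (1 / 2 : ℝ) • (-((ħ ^ 2) • (∂_{EuclideanSpace.single i (1 : ℝ)}
      (∂_{EuclideanSpace.single i (1 : ℝ)} u)))
    + SchwartzMap.smulLeftCLM ℂ (fun x : Space n => (x i) ^ 2) u)

theorem oscillator_apply {n : ℕ} (ħ : ℝ) (i : Fin n) (u : 𝓢(Space n, ℂ)) (x : Space n) :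
    oscillator ħ i u x = (1 / 2 : ℝ) * (-((ħ : ℂ) ^ 2 *
      lineDeriv ℝ (fun y => lineDeriv ℝ u y (EuclideanSpace.single i 1)) x
        (EuclideanSpace.single i 1)) + ((x i : ℝ) : ℂ) ^ 2 * u x) := by
  have hg : (fun x : Space n => (x i) ^ 2).HasTemperateGrowth :=
    (EuclideanSpace.proj (𝕜 := ℝ) i).hasTemperateGrowth.pow 2
  have hd : ((∂_{EuclideanSpace.single i (1 : ℝ)} u : 𝓢(Space n, ℂ)) : Space n → ℂ)
      = fun y => lineDeriv ℝ u y (EuclideanSpace.single i 1) :=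
    funext fun y => SchwartzMap.lineDerivOp_apply _ _ _
  simp only [oscillator, smul_apply, add_apply, neg_apply,
    SchwartzMap.smulLeftCLM_apply_apply hg, SchwartzMap.lineDerivOp_apply, hd,
    Complex.real_smul]
  push_cast
  ring

/-- `E` is the joint spectral measure of `P_1, …, P_n`: one has `∫ λ_i dE = P_i` on Schwartz
functions for every `i`. (The operators `P_i` are essentially self-adjoint on Schwartz functions,
so this says that the self-adjoint operator `∫ λ_i dE` is the closure of `P_i`.) -/
def IsJointSpectralMeasure {n : ℕ} (ħ : ℝ) (E : SpectralMeasure (Space n) (L2 n)) : Prop :=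
  ∀ (i : Fin n) (u : 𝓢(Space n, ℂ)),
    E.HasIntegral (fun t : Space n => ((t i : ℝ) : ℂ)) (u.toLp 2) ((oscillator ħ i u).toLp 2)

/-- The graph of the operator `h(P) = h(P_1, …, P_n)` given by the spectral theorem:
`h(P) x = y`, where `h(P) = ∫ h dE` for the joint spectral measure `E` of `P_1, …, P_n`. -/
def FunctionOfOscillators {n : ℕ} (ħ : ℝ) (h : Space n → ℂ) (x y : L2 n) : Prop :=
  ∃ E : SpectralMeasure (Space n) (L2 n), IsJointSpectralMeasure ħ E ∧ E.HasIntegral h x y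

/-- `h` is either in the Schwartz class or a polynomial function. -/
def IsSchwartzOrPolynomial {n : ℕ} (h : Space n → ℂ) : Prop :=
  (∃ f : 𝓢(Space n, ℂ), ∀ p, h p = f p) ∨
    ∃ q : MvPolynomial (Fin n) ℂ, ∀ p, h p = MvPolynomial.eval (fun i => ((p i : ℝ) : ℂ)) q

/-! ### Weyl quantization -/

/-- The (semiclassical) Wigner function
`W(u,v)(x,ξ) = (2πħ)⁻ⁿ ∫ e^{-i y·ξ/ħ} u(x + y/2) conj(v(x - y/2)) dy`. -/
def wigner {n : ℕ} (ħ : ℝ) (u v : 𝓢(Space n, ℂ)) (z : Space n × Space n) : ℂ :=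
  ((2 * Real.pi * ħ : ℝ) : ℂ)⁻¹ ^ n *
    ∫ y : Space n, Complex.exp (-(Complex.I * ((inner ℝ y z.2 / ħ : ℝ) : ℂ)))
      * u (z.1 + (1 / 2 : ℝ) • y) * conj (v (z.1 - (1 / 2 : ℝ) • y))

/-- `a` is a Weyl symbol of the operator with graph `T`: `a` is a continuous function of at most
polynomial growth on phase space, every Schwartz function `u` is in the domain of the operator,
and `T u = Op(a) u`, where the Weyl quantization
`Op(a) u (x) = (2πħ)⁻ⁿ ∫∫ e^{i (x-y)·ξ/ħ} a((x+y)/2, ξ) u(y) dy dξ`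
is taken in the weak sense `⟨v, Op(a) u⟩ = ∫∫ a(x,ξ) W(u,v)(x,ξ) dx dξ`. -/
def IsWeylSymbol {n : ℕ} (ħ : ℝ) (a : Space n × Space n → ℂ) (T : L2 n → L2 n → Prop) : Prop :=
  Continuous a ∧ (∃ (C : ℝ) (N : ℕ), ∀ z, ‖a z‖ ≤ C * (1 + ‖z‖) ^ N) ∧
    ∀ u : 𝓢(Space n, ℂ), ∃ f : L2 n, T (u.toLp 2) f ∧
      ∀ v : 𝓢(Space n, ℂ), inner ℂ (v.toLp 2) f = ∫ z, a z * wigner ħ u v z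

/-- The classical harmonic oscillators `p_i(x,ξ) = (x_i² + ξ_i²) / 2`. -/
def action {n : ℕ} (z : Space n × Space n) (i : Fin n) : ℝ≥0 :=
  ⟨((z.1 i) ^ 2 + (z.2 i) ^ 2) / 2, by positivity⟩

/-- The point `((k_1 + 1/2) ħ, …, (k_n + 1/2) ħ)`. -/
def level {n : ℕ} (ħ : ℝ) (k : Fin n → ℕ) : Space n :=
  WithLp.toLp 2 fun i => ((k i : ℝ) + 1 / 2) * ħ

end WeylOscillator

end

/-!
The proof diagonalizes everything in the basis of Hermite functions `φ_k` of `L²(ℝⁿ)`. They are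
obtained from the Gaussian by the raising operators, they are eigenfunctions of the oscillators
with eigenvalues `level ħ k`, and they are complete because the Fourier transform of
`conj φ_0 · f` vanishes when `f` is orthogonal to all of them (`eq_zero_of_inner_hermite_eq_zero`).
A joint spectral measure of the oscillators is therefore the one which puts the projection onto
`φ_k` at the point `level ħ k` (`isJointSpectralMeasure_iff`), so that `h(P)` multiplies the `k`-th
Hermite coefficient by `h (level ħ k)` (`functionOfOscillators_iff`). In particular `h(P)`, and
hence every Weyl symbol of it, depends only on these values.

It remains to see that a Weyl symbol is unique, and that there is one which is a function of the
classical oscillators `p_j`.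

* Uniqueness (`IsAdmissible.eq_zero_of_integral_eq_zero`): a continuous function `a` of polynomial
  growth which is orthogonal to all Wigner functions is orthogonal to `exp (i ℓ) W(φ_0, φ_0)` for
  every real linear form `ℓ` on phase space, as these are again Wigner functions. So the Fourier
  transform of the integrable function `a W(φ_0, φ_0)` vanishes; but `W(φ_0, φ_0)` is a
  nowhere vanishing Gaussian.

* Recursion: `p_j W(u, v)` is a combination of the Wigner functions obtained by applying to `u` and
  `v` the oscillator, the raising or the lowering operator (`action_mul_wigner`). On symbols this
  means that multiplication by `p_j` preserves the class of symbols of operators which are diagonal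
  in the Hermite basis, and acts on the eigenvalues by the difference operator `actionShift`.

* Polynomials (`hasRadialSymbol_eval`): starting from the symbol `1` of the identity, the monomials
  in the `p_j` are the symbols of products of the explicit one-variable polynomials `ladderPoly` of
  the oscillators, and these products span all polynomials.

* Schwartz functions (`hasRadialSymbol_of_summable`): by Moyal's identity `(2πħ)ⁿ W(φ_k, φ_k)` is
  the symbol of the projection onto `φ_k`. It is bounded by `2ⁿ`, and by the recursion it is a
  function of the `p_j`. So the series `∑ h (level ħ k) (2πħ)ⁿ W(φ_k, φ_k)` converges to the symbol.
-/

namespace WeylOscillator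

/-! ### The Gaussian ground state -/

/-- A Gaussian dominates every power of `1 + ‖x‖`. -/
theorem exists_pow_mul_exp_neg_sq_le {b : ℝ} (hb : 0 < b) (N : ℕ) :
    ∃ C : ℝ, ∀ r : ℝ, 0 ≤ r → (1 + r) ^ N * Real.exp (-b * r ^ 2) ≤ C := by
  refine ⟨N.factorial * Real.exp (1 + 1 / (4 * b)), fun r hr => ?_⟩
  have h1 : (1 + r) ^ N ≤ N.factorial * Real.exp (1 + r) := by
    have := Real.pow_div_factorial_le_exp (1 + r) (by positivity) N
    rwa [div_le_iff₀' (by positivity)] at this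
  have h2 : 1 + r + -b * r ^ 2 ≤ 1 + 1 / (4 * b) := by
    have h3 : 1 / (4 * b) - r + b * r ^ 2 = (1 - 2 * b * r) ^ 2 / (4 * b) := by
      field_simp
      ring
    have h4 : 0 ≤ (1 - 2 * b * r) ^ 2 / (4 * b) := by positivity
    linarith
  calc (1 + r) ^ N * Real.exp (-b * r ^ 2)
      ≤ N.factorial * Real.exp (1 + r) * Real.exp (-b * r ^ 2) := by gcongr
    _ = N.factorial * Real.exp (1 + r + -b * r ^ 2) := by rw [mul_assoc, ← Real.exp_add]
    _ ≤ _ := by gcongr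

/-- The Gaussian `exp (-b ‖x‖²)` as a Schwartz function. -/
noncomputable def gaussian (n : ℕ) (b : ℝ) (hb : 0 < b) : 𝓢(Space n, ℂ) where
  toFun x := Complex.exp ((-b * ‖x‖ ^ 2 : ℝ) : ℂ)
  smooth' := by
    have : ContDiff ℝ (⊤ : ℕ∞) fun x : Space n => ((-b * ‖x‖ ^ 2 : ℝ) : ℂ) :=
      Complex.ofRealCLM.contDiff.comp (contDiff_const.mul (contDiff_norm_sq ℝ))
    exact this.cexp
  decay' := by
    intro k m
    have hf : (fun x : Space n => -b * ‖x‖ ^ 2).HasTemperateGrowth :=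
      (Function.HasTemperateGrowth.const (-b)).mul (Function.hasTemperateGrowth_norm_sq (Space n))
    obtain ⟨l, C, hC, hbd⟩ := hf.norm_iteratedFDeriv_le_uniform m
    obtain ⟨M, hM⟩ := exists_pow_mul_exp_neg_sq_le hb (k + l * m)
    refine ⟨m.factorial * (C + 1) ^ m * M, fun x => ?_⟩
    have hcomp : (fun x : Space n => Complex.exp ((-b * ‖x‖ ^ 2 : ℝ) : ℂ))
        = (fun t : ℝ => Complex.ofRealCLM (Real.exp t)) ∘ fun x : Space n => -b * ‖x‖ ^ 2 := by
      ext x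
      simp
    have hg : ContDiff ℝ (⊤ : ℕ∞) (fun t : ℝ => Complex.ofRealCLM (Real.exp t)) :=
      Complex.ofRealCLM.contDiff.comp Real.contDiff_exp
    have hD : ∀ i, 1 ≤ i → i ≤ m → ‖iteratedFDeriv ℝ i (fun x : Space n => -b * ‖x‖ ^ 2) x‖
        ≤ ((C + 1) * (1 + ‖x‖) ^ l) ^ i := by
      intro i h1 hi
      have h2 : 1 ≤ (C + 1) * (1 + ‖x‖) ^ l := by
        have := one_le_pow₀ (n := l) (show 1 ≤ 1 + ‖x‖ by linarith [norm_nonneg x])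
        nlinarith
      calc _ ≤ C * (1 + ‖x‖) ^ l := hbd i hi x
        _ ≤ (C + 1) * (1 + ‖x‖) ^ l := by gcongr; linarith
        _ ≤ _ := le_self_pow₀ h2 (by omega)
    have hgC : ∀ i, i ≤ m → ‖iteratedFDeriv ℝ i (fun t : ℝ => Complex.ofRealCLM (Real.exp t))
        (-b * ‖x‖ ^ 2)‖ ≤ Real.exp (-b * ‖x‖ ^ 2) := by
      intro i _
      have h3 : iteratedFDeriv ℝ i (fun t : ℝ => Complex.ofRealCLM (Real.exp t)) (-b * ‖x‖ ^ 2)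
          = Complex.ofRealCLM.compContinuousMultilinearMap
            (iteratedFDeriv ℝ i Real.exp (-b * ‖x‖ ^ 2)) :=
        Complex.ofRealCLM.iteratedFDeriv_comp_left
          (Real.contDiff_exp (n := (⊤ : ℕ∞))).contDiffAt (by exact_mod_cast le_top)
      rw [h3]
      refine (ContinuousLinearMap.norm_compContinuousMultilinearMap_le _ _).trans ?_
      rw [Complex.ofRealCLM_norm, one_mul, norm_iteratedFDeriv_eq_norm_iteratedDeriv,
        iteratedDeriv_eq_iterate, Real.iter_deriv_exp, Real.norm_eq_abs, Real.abs_exp]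
    have := norm_iteratedFDeriv_comp_le hg hf.1 (by exact_mod_cast le_top) x hgC hD
    rw [hcomp]
    calc _ ≤ (1 + ‖x‖) ^ k * (m.factorial * Real.exp (-b * ‖x‖ ^ 2)
            * ((C + 1) * (1 + ‖x‖) ^ l) ^ m) := by
          gcongr
          linarith [norm_nonneg x]
      _ = m.factorial * (C + 1) ^ m
            * ((1 + ‖x‖) ^ (k + l * m) * Real.exp (-b * ‖x‖ ^ 2)) := by
          rw [mul_pow, ← pow_mul, pow_add]; ring
      _ ≤ _ := by gcongr; exact hM _ (norm_nonneg x)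

theorem gaussian_apply (n : ℕ) (b : ℝ) (hb : 0 < b) (x : Space n) :
    gaussian n b hb x = Complex.exp ((-b * ‖x‖ ^ 2 : ℝ) : ℂ) := rfl

/-! ### Position, derivative and ladder operators on Schwartz functions -/

variable {n : ℕ}

/-- Multiplication by the coordinate `x_j`. -/
noncomputable def position (j : Fin n) : 𝓢(Space n, ℂ) →L[ℂ] 𝓢(Space n, ℂ) :=
  SchwartzMap.smulLeftCLM ℂ (fun x : Space n => ((x j : ℝ) : ℂ))

/-- The partial derivative `∂_j`. -/
noncomputable def partialDeriv (j : Fin n) : 𝓢(Space n, ℂ) →L[ℂ] 𝓢(Space n, ℂ) :=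
  LineDeriv.lineDerivOpCLM ℂ 𝓢(Space n, ℂ) (EuclideanSpace.single j (1 : ℝ))

/-- The creation operator `x_j - ħ ∂_j`, without normalization. -/
noncomputable def raising (ħ : ℝ) (j : Fin n) : 𝓢(Space n, ℂ) →L[ℂ] 𝓢(Space n, ℂ) :=
  position j - (ħ : ℂ) • partialDeriv j

/-- The annihilation operator `x_j + ħ ∂_j`, without normalization. -/
noncomputable def lowering (ħ : ℝ) (j : Fin n) : 𝓢(Space n, ℂ) →L[ℂ] 𝓢(Space n, ℂ) :=
  position j + (ħ : ℂ) • partialDeriv j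

theorem hasTemperateGrowth_coord (j : Fin n) :
    (fun x : Space n => ((x j : ℝ) : ℂ)).HasTemperateGrowth :=
  (Complex.ofRealCLM.comp (EuclideanSpace.proj (𝕜 := ℝ) j)).hasTemperateGrowth

theorem position_apply (j : Fin n) (u : 𝓢(Space n, ℂ)) (x : Space n) :
    position j u x = (x j : ℂ) * u x := by
  simp [position, SchwartzMap.smulLeftCLM_apply_apply (hasTemperateGrowth_coord j)]

theorem partialDeriv_apply (j : Fin n) (u : 𝓢(Space n, ℂ)) (x : Space n) :
    partialDeriv j u x = fderiv ℝ u x (EuclideanSpace.single j 1) := by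
  simp [partialDeriv, SchwartzMap.lineDerivOp_apply_eq_fderiv]

theorem partialDeriv_comm (i j : Fin n) : Commute (partialDeriv i) (partialDeriv j) := by
  ext u x
  simp only [mul_apply_eq_comp, partialDeriv_apply]
  have hfun : ∀ l : Fin n, (⇑(partialDeriv l u) : Space n → ℂ)
      = fun y => fderiv ℝ u y (EuclideanSpace.single l 1) :=
    fun l => funext (partialDeriv_apply l u)
  have hd : DifferentiableAt ℝ (fderiv ℝ u) x :=
    ((u.smooth 2).fderiv_right (m := 1) (by norm_num)).differentiable (by norm_num) x
  rw [hfun, hfun, fderiv_clm_apply hd (differentiableAt_const _),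
    fderiv_clm_apply hd (differentiableAt_const _)]
  have hs : IsSymmSndFDerivAt ℝ (u : Space n → ℂ) x :=
    ((u.smooth 2).contDiffAt).isSymmSndFDerivAt (by simp)
  simpa using hs.eq _ _

theorem position_comm (i j : Fin n) : Commute (position i) (position j) := by
  ext u x
  simp only [mul_apply_eq_comp, position_apply]
  ring

theorem partialDeriv_position (i j : Fin n) :
    partialDeriv i * position j = position j * partialDeriv i + if i = j then 1 else 0 := by
  ext u x
  have h1 : HasFDerivAt (fun y : Space n => ((y j : ℝ) : ℂ))
      (Complex.ofRealCLM.comp (EuclideanSpace.proj (𝕜 := ℝ) j)) x :=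
    (Complex.ofRealCLM.comp (EuclideanSpace.proj (𝕜 := ℝ) j)).hasFDerivAt
  have h2 : HasFDerivAt (fun y : Space n => (y j : ℂ) * u y) _ x := h1.mul (u.hasFDerivAt x)
  have hfun : (⇑(position j u) : Space n → ℂ) = fun y => (y j : ℂ) * u y :=
    funext (position_apply j u)
  simp only [mul_apply_eq_comp, partialDeriv_apply, add_apply,
    hfun, add_apply, position_apply]
  rw [h2.fderiv]
  by_cases hij : i = j
  · subst hij; simp
  · have : (j = i) = False := by simp [eq_comm, hij]
    simp [hij, this]

theorem raising_comm (ħ : ℝ) (i j : Fin n) : Commute (raising ħ i) (raising ħ j) := by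
  have h1 := partialDeriv_position i j
  have h2 := partialDeriv_position j i
  have h3 := (partialDeriv_comm i j).eq
  have h4 := (position_comm i j).eq
  simp only [Commute, SemiconjBy, raising, sub_mul, mul_sub, smul_mul_assoc, mul_smul_comm, h1, h2,
    h3, h4]
  by_cases hij : i = j
  · subst hij; abel
  · have : (j = i) = False := by simp [eq_comm, hij]
    simp only [hij, this, if_false]
    module

theorem lowering_raising (ħ : ℝ) (i j : Fin n) :
    lowering ħ i * raising ħ j
      = raising ħ j * lowering ħ i + if i = j then (2 * ħ : ℂ) • 1 else 0 := by
  have h1 := partialDeriv_position i j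
  have h2 := partialDeriv_position j i
  have h3 := (partialDeriv_comm i j).eq
  have h4 := (position_comm i j).eq
  simp only [lowering, raising, sub_mul, mul_sub, add_mul, mul_add, smul_mul_assoc, mul_smul_comm,
    h1, h2, h3, h4]
  by_cases hij : i = j
  · subst hij
    simp only [if_true]
    module
  · have : (j = i) = False := by simp [eq_comm, hij]
    simp only [hij, this, if_false]
    module

/-- The oscillator is half the number operator `raising * lowering` plus the zero-point energy
`ħ / 2`. -/
theorem two_smul_oscillator (ħ : ℝ) (i : Fin n) (u : 𝓢(Space n, ℂ)) :
    (2 : ℂ) • oscillator ħ i u = raising ħ i (lowering ħ i u) + (ħ : ℂ) • u := by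
  have h1 := congrArg (fun T => T u) (partialDeriv_position i i)
  simp only [if_true, mul_apply_eq_comp, add_apply,
    one_apply_eq_self] at h1
  have hg : (fun x : Space n => (x i) ^ 2).HasTemperateGrowth :=
    (EuclideanSpace.proj (𝕜 := ℝ) i).hasTemperateGrowth.pow 2
  have h2 : SchwartzMap.smulLeftCLM ℂ (fun x : Space n => (x i) ^ 2) u
      = position i (position i u) := by
    ext x
    simp only [SchwartzMap.smulLeftCLM_apply_apply hg, position_apply, Complex.real_smul]
    push_cast
    ring
  have h3 : (∂_{EuclideanSpace.single i (1 : ℝ)} (∂_{EuclideanSpace.single i (1 : ℝ)} u)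
      : 𝓢(Space n, ℂ)) = partialDeriv i (partialDeriv i u) := rfl
  ext x
  simp only [oscillator, raising, lowering, h2, h3, add_apply,
    sub_apply, smul_apply, map_add, map_smul, h1,
    add_apply, smul_apply, sub_apply, neg_apply,
    Complex.real_smul, smul_eq_mul]
  push_cast
  ring

theorem raising_pow_pairwise (ħ : ℝ) (k : Fin n → ℕ) :
    ((Finset.univ : Finset (Fin n)) : Set (Fin n)).Pairwise
      (Function.onFun Commute fun j => raising ħ j ^ k j) :=
  fun i _ j _ _ => (raising_comm ħ i j).pow_pow _ _

/-- The Hermite state `∏ (x_j - ħ ∂_j)^{k_j} exp (-‖x‖² / 2ħ)`, without normalization. -/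
noncomputable def hermiteRaw (ħ : ℝ) (hħ : 0 < ħ) (k : Fin n → ℕ) : 𝓢(Space n, ℂ) :=
  Finset.univ.noncommProd (fun j => raising ħ j ^ k j)
    (raising_pow_pairwise ħ k) (gaussian n (1 / (2 * ħ)) (by positivity))

theorem hermiteRaw_zero (ħ : ℝ) (hħ : 0 < ħ) :
    hermiteRaw ħ hħ (0 : Fin n → ℕ) = gaussian n (1 / (2 * ħ)) (by positivity) := by
  unfold hermiteRaw
  rw [Finset.noncommProd_eq_pow_card _ _ _ 1 (by simp)]
  simp

theorem raising_hermiteRaw (ħ : ℝ) (hħ : 0 < ħ) (k : Fin n → ℕ) (j : Fin n) :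
    raising ħ j (hermiteRaw ħ hħ k) = hermiteRaw ħ hħ (k + Pi.single j 1) := by
  have key : ∀ l : Fin n → ℕ, Finset.univ.noncommProd (fun i => raising ħ i ^ l i)
      (raising_pow_pairwise ħ l) = raising ħ j ^ l j *
        (Finset.univ.erase j).noncommProd (fun i => raising ħ i ^ l i)
          ((raising_pow_pairwise ħ l).mono (by simp)) :=
    fun l => (Finset.mul_noncommProd_erase _ (Finset.mem_univ j) _ _).symm
  have hrest : (Finset.univ.erase j).noncommProd (fun i => raising ħ i ^ k i)
        ((raising_pow_pairwise ħ k).mono (by simp))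
      = (Finset.univ.erase j).noncommProd (fun i => raising ħ i ^ (k + Pi.single j 1 : Fin n → ℕ) i)
        ((raising_pow_pairwise ħ (k + Pi.single j 1)).mono (by simp)) := by
    refine Finset.noncommProd_congr rfl (fun i hi => ?_) _
    rw [Finset.mem_erase] at hi
    simp [hi.1]
  unfold hermiteRaw
  rw [key, key, hrest, ← mul_apply_eq_comp, ← mul_assoc, ← pow_succ']
  simp

theorem sub_single_add_single {k : Fin n → ℕ} {j : Fin n} (hk : k j ≠ 0) :
    k - Pi.single j 1 + Pi.single j 1 = k := by
  ext i
  by_cases hi : i = j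
  · subst hi
    simp
    omega
  · simp [hi]

/-- Multi-indices are built from `0` by raising single entries. The hypothesis of the step covers
all multi-indices of at most the same degree, as required by two-step recursions. -/
theorem multiIndex_induction {p : (Fin n → ℕ) → Prop} (h0 : p 0)
    (hs : ∀ (k : Fin n → ℕ) j, (∀ l : Fin n → ℕ, ∑ i, l i ≤ ∑ i, k i → p l) →
      p (k + Pi.single j 1)) (k : Fin n → ℕ) : p k := by
  induction hd : ∑ i, k i using Nat.strong_induction_on generalizing k with
  | _ d ih =>
    by_cases hk : k = 0
    · exact hk ▸ h0
    · obtain ⟨j, hj⟩ := Function.ne_iff.mp hk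
      have hkj := sub_single_add_single hj
      have hsum : ∑ i, (k - Pi.single j 1 : Fin n → ℕ) i + 1 = ∑ i, k i := by
        conv_rhs => rw [← hkj]
        simp [Finset.sum_add_distrib, Finset.sum_pi_single']
      rw [← hkj]
      exact hs _ _ fun l hl => ih _ (by omega) l rfl

theorem lowering_gaussian (ħ : ℝ) (hħ : 0 < ħ) (i : Fin n) :
    lowering ħ i (gaussian n (1 / (2 * ħ)) (by positivity)) = 0 := by
  ext x
  have hd : HasFDerivAt (fun y : Space n => Complex.exp ((-(1 / (2 * ħ)) * ‖y‖ ^ 2 : ℝ) : ℂ))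
      (Complex.exp ((-(1 / (2 * ħ)) * ‖x‖ ^ 2 : ℝ) : ℂ) •
        (Complex.ofRealCLM.comp (-(1 / (2 * ħ)) • (2 • innerSL ℝ x)))) x := by
    have h1 := (hasStrictFDerivAt_norm_sq x).hasFDerivAt.const_mul (-(1 / (2 * ħ)))
    exact (Complex.ofRealCLM.hasFDerivAt.comp x h1).cexp
  have hfun : (⇑(gaussian n (1 / (2 * ħ)) (by positivity)) : Space n → ℂ)
      = fun y => Complex.exp ((-(1 / (2 * ħ)) * ‖y‖ ^ 2 : ℝ) : ℂ) := rfl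
  have hħ' : (ħ : ℂ) ≠ 0 := by exact_mod_cast hħ.ne'
  simp only [lowering, add_apply, smul_apply, position_apply, partialDeriv_apply, hfun, hd.fderiv]
  simp only [smul_apply, ContinuousLinearMap.comp_apply, innerSL_apply_apply,
    EuclideanSpace.inner_single_right, Complex.ofRealCLM_apply, smul_eq_mul, nsmul_eq_mul]
  simp
  field_simp
  ring

/-- The lowering relations, by induction on the multi-index from the commutation relation
`lowering_raising`. -/
theorem lowering_hermiteRaw_add (ħ : ℝ) (hħ : 0 < ħ) (i : Fin n) (k : Fin n → ℕ) :
    lowering ħ i (hermiteRaw ħ hħ (k + Pi.single i 1))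
        = (2 * ħ * (k i + 1) : ℂ) • hermiteRaw ħ hħ k ∧
      (k i = 0 → lowering ħ i (hermiteRaw ħ hħ k) = 0) := by
  induction k using multiIndex_induction with
  | h0 =>
    have h0 : lowering ħ i (hermiteRaw ħ hħ (0 : Fin n → ℕ)) = 0 := by
      rw [hermiteRaw_zero, lowering_gaussian ħ hħ]
    refine ⟨?_, fun _ => h0⟩
    rw [← raising_hermiteRaw, ← mul_apply_eq_comp, lowering_raising,
      add_apply, mul_apply_eq_comp, h0]
    simp
  | hs k j ih =>
    have h1 : ∀ l, lowering ħ i (hermiteRaw ħ hħ (l + Pi.single j 1))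
        = raising ħ j (lowering ħ i (hermiteRaw ħ hħ l))
          + if i = j then (2 * ħ : ℂ) • hermiteRaw ħ hħ l else 0 := by
      intro l
      rw [← raising_hermiteRaw, ← mul_apply_eq_comp, lowering_raising,
        add_apply, mul_apply_eq_comp]
      split_ifs <;> simp
    obtain ⟨h2, h3⟩ := ih k le_rfl
    constructor
    · rw [add_right_comm, h1, h2, map_smul, raising_hermiteRaw]
      by_cases hij : i = j
      · subst hij
        simp only [if_true, ← add_smul, Pi.add_apply, Pi.single_eq_same]
        congr 1
        push_cast
        ring
      · simp [hij]
    · intro hk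
      by_cases hij : i = j
      · subst hij; simp at hk
      · rw [h1, h3 (by simpa [hij] using hk)]
        simp [hij]

/-! ### Hermite states in `L²` -/

/-- The `L²` inner product of Schwartz functions, conjugate-linear in the first argument. -/
noncomputable def ip (u v : 𝓢(Space n, ℂ)) : ℂ := inner ℂ (u.toLp 2) (v.toLp 2)

theorem ip_eq_integral (u v : 𝓢(Space n, ℂ)) : ip u v = ∫ x, conj (u x) * v x := by
  rw [ip, SchwartzMap.inner_toL2_toL2_eq u v volume]
  simp [mul_comm]

theorem toLp_add (u v : 𝓢(Space n, ℂ)) :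
    (u + v).toLp 2 volume = u.toLp 2 volume + v.toLp 2 volume :=
  map_add (SchwartzMap.toLpCLM ℂ ℂ 2 volume) u v

theorem toLp_sub (u v : 𝓢(Space n, ℂ)) :
    (u - v).toLp 2 volume = u.toLp 2 volume - v.toLp 2 volume :=
  map_sub (SchwartzMap.toLpCLM ℂ ℂ 2 volume) u v

theorem toLp_smul (c : ℂ) (u : 𝓢(Space n, ℂ)) : (c • u).toLp 2 = c • u.toLp 2 :=
  map_smul (SchwartzMap.toLpCLM ℂ ℂ 2 volume) c u

theorem toLp_zero : (0 : 𝓢(Space n, ℂ)).toLp 2 = 0 :=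
  map_zero (SchwartzMap.toLpCLM ℂ ℂ 2 volume)

theorem ip_add_left (u u' v : 𝓢(Space n, ℂ)) : ip (u + u') v = ip u v + ip u' v := by
  simp only [ip, toLp_add, inner_add_left]

theorem ip_add_right (u v v' : 𝓢(Space n, ℂ)) : ip u (v + v') = ip u v + ip u v' := by
  simp only [ip, toLp_add, inner_add_right]

theorem ip_sub_left (u u' v : 𝓢(Space n, ℂ)) : ip (u - u') v = ip u v - ip u' v := by
  simp only [ip, toLp_sub, inner_sub_left]

theorem ip_smul_left (c : ℂ) (u v : 𝓢(Space n, ℂ)) : ip (c • u) v = conj c * ip u v := by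
  simp only [ip, toLp_smul, inner_smul_left]

theorem ip_smul_right (c : ℂ) (u v : 𝓢(Space n, ℂ)) : ip u (c • v) = c * ip u v := by
  simp only [ip, toLp_smul, inner_smul_right]

theorem ip_zero_right (v : 𝓢(Space n, ℂ)) : ip v 0 = 0 := by simp [ip, toLp_zero]

theorem conj_ip (u v : 𝓢(Space n, ℂ)) : conj (ip u v) = ip v u := inner_conj_symm _ _

theorem ip_position (j : Fin n) (u v : 𝓢(Space n, ℂ)) :
    ip (position j u) v = ip u (position j v) := by
  simp only [ip_eq_integral, position_apply, map_mul, Complex.conj_ofReal]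
  congr 1 with x
  ring

theorem ip_partialDeriv (j : Fin n) (u v : 𝓢(Space n, ℂ)) :
    ip (partialDeriv j u) v = -ip u (partialDeriv j v) := by
  have h := SchwartzMap.integral_bilinear_lineDerivOp_right_eq_neg_left (μ := volume) u v
    ((ContinuousLinearMap.mul ℝ ℂ).comp (Complex.conjCLE : ℂ →L[ℝ] ℂ))
    (EuclideanSpace.single j (1 : ℝ))
  simp only [ip_eq_integral]
  exact neg_eq_iff_eq_neg.mp h.symm

theorem ip_raising (ħ : ℝ) (j : Fin n) (u v : 𝓢(Space n, ℂ)) :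
    ip (raising ħ j u) v = ip u (lowering ħ j v) := by
  simp only [raising, lowering, sub_apply, add_apply, smul_apply, ip_sub_left, ip_add_right,
    ip_smul_left, ip_smul_right, ip_position, ip_partialDeriv, Complex.conj_ofReal]
  ring

theorem ip_lowering (ħ : ℝ) (j : Fin n) (u v : 𝓢(Space n, ℂ)) :
    ip (lowering ħ j u) v = ip u (raising ħ j v) := by
  rw [← conj_ip, ← ip_raising, conj_ip]

theorem ip_oscillator (ħ : ℝ) (j : Fin n) (u v : 𝓢(Space n, ℂ)) :
    ip (oscillator ħ j u) v = ip u (oscillator ħ j v) := by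
  have h : ip ((2 : ℂ) • oscillator ħ j u) v = ip u ((2 : ℂ) • oscillator ħ j v) := by
    rw [two_smul_oscillator, two_smul_oscillator, ip_add_left, ip_add_right, ip_raising,
      ip_smul_left, ip_smul_right, ← ip_lowering, Complex.conj_ofReal]
  rw [ip_smul_left, ip_smul_right, map_ofNat] at h
  exact mul_left_cancel₀ two_ne_zero h

/-- The `L²` norm of an unnormalized Hermite state. -/
noncomputable def hermiteNorm (ħ : ℝ) (hħ : 0 < ħ) (k : Fin n → ℕ) : ℝ :=
  ‖(hermiteRaw ħ hħ k).toLp 2‖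

theorem hermiteNorm_add_single (ħ : ℝ) (hħ : 0 < ħ) (k : Fin n → ℕ) (j : Fin n) :
    hermiteNorm ħ hħ (k + Pi.single j 1)
      = √(2 * ħ * (k j + 1)) * hermiteNorm ħ hħ k := by
  have h1 : ip (hermiteRaw ħ hħ (k + Pi.single j 1)) (hermiteRaw ħ hħ (k + Pi.single j 1))
      = (2 * ħ * (k j + 1) : ℂ) * ip (hermiteRaw ħ hħ k) (hermiteRaw ħ hħ k) := by
    conv_lhs => rw [← raising_hermiteRaw ħ hħ k j, ip_raising, raising_hermiteRaw,
      (lowering_hermiteRaw_add ħ hħ j k).1, ip_smul_right]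
  have h2 : hermiteNorm ħ hħ (k + Pi.single j 1) ^ 2
      = (2 * ħ * (k j + 1)) * hermiteNorm ħ hħ k ^ 2 := by
    simp only [ip, inner_self_eq_norm_sq_to_K] at h1
    unfold hermiteNorm
    apply Complex.ofReal_injective
    push_cast
    exact h1
  have h3 : (0 : ℝ) ≤ 2 * ħ * (k j + 1) := by positivity
  have h4 : (√(2 * ħ * (k j + 1)) * hermiteNorm ħ hħ k) ^ 2
      = (2 * ħ * (k j + 1)) * hermiteNorm ħ hħ k ^ 2 := by
    rw [mul_pow, Real.sq_sqrt h3]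
  rw [← h4] at h2
  exact (pow_left_inj₀ (norm_nonneg _)
    (mul_nonneg (Real.sqrt_nonneg _) (norm_nonneg _)) two_ne_zero).mp h2

theorem hermiteNorm_pos (ħ : ℝ) (hħ : 0 < ħ) (k : Fin n → ℕ) : 0 < hermiteNorm ħ hħ k := by
  induction k using multiIndex_induction with
  | h0 =>
    refine norm_pos_iff.mpr fun h => ?_
    have h1 := SchwartzMap.injective_toLp 2 volume (h.trans toLp_zero.symm)
    have h2 := congrArg (fun u : 𝓢(Space n, ℂ) => u 0) h1
    rw [hermiteRaw_zero] at h2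
    simp [gaussian_apply] at h2
  | hs k j ih =>
    rw [hermiteNorm_add_single]
    have := ih k le_rfl
    positivity

/-- The normalized Hermite states, an orthonormal basis of joint eigenfunctions of the
oscillators. -/
noncomputable def hermite (ħ : ℝ) (hħ : 0 < ħ) (k : Fin n → ℕ) : 𝓢(Space n, ℂ) :=
  ((hermiteNorm ħ hħ k : ℝ) : ℂ)⁻¹ • hermiteRaw ħ hħ k

theorem raising_hermite (ħ : ℝ) (hħ : 0 < ħ) (k : Fin n → ℕ) (j : Fin n) :
    raising ħ j (hermite ħ hħ k)
      = ((√(2 * ħ * (k j + 1)) : ℝ) : ℂ) • hermite ħ hħ (k + Pi.single j 1) := by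
  have h1 : ((hermiteNorm ħ hħ k : ℝ) : ℂ) ≠ 0 := by
    exact_mod_cast (hermiteNorm_pos ħ hħ k).ne'
  have h2 : ((√(2 * ħ * (k j + 1)) : ℝ) : ℂ) ≠ 0 := by
    have : 0 < 2 * ħ * ((k j : ℝ) + 1) := by positivity
    exact_mod_cast (Real.sqrt_pos.mpr this).ne'
  rw [hermite, hermite, map_smul, raising_hermiteRaw, hermiteNorm_add_single, smul_smul]
  congr 1
  push_cast
  field_simp

theorem lowering_hermite_add (ħ : ℝ) (hħ : 0 < ħ) (k : Fin n → ℕ) (j : Fin n) :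
    lowering ħ j (hermite ħ hħ (k + Pi.single j 1))
      = ((√(2 * ħ * (k j + 1)) : ℝ) : ℂ) • hermite ħ hħ k := by
  have h1 : ((hermiteNorm ħ hħ k : ℝ) : ℂ) ≠ 0 := by
    exact_mod_cast (hermiteNorm_pos ħ hħ k).ne'
  have h0 : 0 < 2 * ħ * ((k j : ℝ) + 1) := by positivity
  have h2 : ((√(2 * ħ * (k j + 1)) : ℝ) : ℂ) ≠ 0 := by
    exact_mod_cast (Real.sqrt_pos.mpr h0).ne'
  have h3 : (2 * ħ * (k j + 1) : ℂ)
      = ((√(2 * ħ * (k j + 1)) : ℝ) : ℂ) * ((√(2 * ħ * (k j + 1)) : ℝ) : ℂ) := by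
    exact_mod_cast (Real.mul_self_sqrt h0.le).symm
  rw [hermite, hermite, map_smul, (lowering_hermiteRaw_add ħ hħ j k).1, hermiteNorm_add_single,
    smul_smul, smul_smul, h3]
  congr 1
  push_cast
  field_simp

theorem lowering_hermite_of_eq_zero (ħ : ℝ) (hħ : 0 < ħ) {k : Fin n → ℕ} {j : Fin n}
    (hk : k j = 0) : lowering ħ j (hermite ħ hħ k) = 0 := by
  rw [hermite, map_smul, (lowering_hermiteRaw_add ħ hħ j k).2 hk, smul_zero]

theorem oscillator_hermite (ħ : ℝ) (hħ : 0 < ħ) (k : Fin n → ℕ) (j : Fin n) :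
    oscillator ħ j (hermite ħ hħ k) = ((level ħ k j : ℝ) : ℂ) • hermite ħ hħ k := by
  have h : (2 : ℂ) • oscillator ħ j (hermite ħ hħ k)
      = (2 : ℂ) • (((level ħ k j : ℝ) : ℂ) • hermite ħ hħ k) := by
    rw [two_smul_oscillator]
    by_cases hk : k j = 0
    · rw [lowering_hermite_of_eq_zero ħ hħ hk, map_zero, zero_add, smul_smul]
      congr 1
      simp [level, hk]
    · obtain ⟨l, rfl⟩ : ∃ l : Fin n → ℕ, k = l + Pi.single j 1 :=
        ⟨_, (sub_single_add_single hk).symm⟩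
      have h0 : 0 < 2 * ħ * ((l j : ℝ) + 1) := by positivity
      have h3 : ((√(2 * ħ * (l j + 1)) : ℝ) : ℂ) * ((√(2 * ħ * (l j + 1)) : ℝ) : ℂ)
          = (2 * ħ * (l j + 1) : ℂ) := by
        exact_mod_cast Real.mul_self_sqrt h0.le
      rw [lowering_hermite_add, map_smul, raising_hermite, smul_smul, h3, ← add_smul, smul_smul]
      congr 1
      simp [level]
      ring
  exact smul_right_injective _ (two_ne_zero (α := ℂ)) h

/-- Orthogonality holds because distinct Hermite states have distinct eigenvalues under some
oscillator. -/
theorem orthonormal_hermite (ħ : ℝ) (hħ : 0 < ħ) :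
    Orthonormal ℂ (fun k : Fin n → ℕ => (hermite ħ hħ k).toLp 2 (volume : Measure (Space n))) := by
  constructor
  · intro k
    have h := hermiteNorm_pos ħ hħ k
    simp only [hermite]
    rw [toLp_smul, norm_smul, norm_inv, Complex.norm_real, Real.norm_of_nonneg h.le]
    exact inv_mul_cancel₀ h.ne'
  · intro k l hkl
    obtain ⟨j, hj⟩ := Function.ne_iff.mp hkl
    have h := ip_oscillator ħ j (hermite ħ hħ k) (hermite ħ hħ l)
    rw [oscillator_hermite, oscillator_hermite, ip_smul_left, ip_smul_right, Complex.conj_ofReal,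
      ← sub_eq_zero, ← sub_mul] at h
    refine (mul_eq_zero.mp h).resolve_left fun h0 => hj ?_
    rw [sub_eq_zero] at h0
    have h1 : level ħ k j = level ħ l j := by exact_mod_cast h0
    have h2 : ((k j : ℝ) + 1 / 2) * ħ = ((l j : ℝ) + 1 / 2) * ħ := h1
    have h3 := mul_right_cancel₀ hħ.ne' h2
    exact_mod_cast add_right_cancel h3

/-! ### Completeness of the Hermite states -/

/-- Injectivity of the Fourier transform on `L¹`: by the multiplication formula, `g` is orthogonal
to the Fourier transforms of Schwartz functions, among them all test functions. -/
theorem ae_eq_zero_of_fourier_eq_zero {V : Type*} [NormedAddCommGroup V] [InnerProductSpace ℝ V]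
    [FiniteDimensional ℝ V] [MeasurableSpace V] [BorelSpace V] {g : V → ℂ} (hg : Integrable g)
    (h : ∀ w : V, FourierTransform.fourier g w = 0) : ∀ᵐ x, g x = 0 := by
  refine ae_eq_zero_of_integral_contDiff_smul_eq_zero hg.locallyIntegrable fun χ hχ hc => ?_
  have hc' : HasCompactSupport fun x => (χ x : ℂ) := hc.comp_left (g := ((↑) : ℝ → ℂ)) (by simp)
  have hχ' : ContDiff ℝ (⊤ : ℕ∞) fun x => (χ x : ℂ) := Complex.ofRealCLM.contDiff.comp hχ
  set ψ : 𝓢(V, ℂ) := hc'.toSchwartzMap hχ' with hψ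
  have h1 := VectorFourier.integral_fourierIntegral_smul_eq_flip (L := innerₗ V) (μ := volume)
    (ν := volume) Real.continuous_fourierChar continuous_inner hg
    ((FourierTransform.fourierInv ψ : 𝓢(V, ℂ))).integrable
  have h2 : ∀ ξ, VectorFourier.fourierIntegral Real.fourierChar volume (innerₗ V) g ξ = 0 := h
  have h3 : ∀ x, VectorFourier.fourierIntegral Real.fourierChar volume (innerₗ V).flip
      (⇑(FourierTransform.fourierInv ψ : 𝓢(V, ℂ))) x = χ x := by
    intro x
    have h4 := congrArg (fun f : 𝓢(V, ℂ) => f x)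
      (FourierTransform.fourier_fourierInv_eq (F := 𝓢(V, ℂ)) ψ)
    rw [flip_innerₗ]
    exact h4
  simp only [h2, h3, zero_smul, integral_zero] at h1
  rw [h1]
  congr 1 with x
  simp [mul_comm]

/-- Multiplication of Schwartz functions by the linear form `x ↦ ⟪x, w⟫`. -/
noncomputable def linearMultiplier (w : Space n) : 𝓢(Space n, ℂ) →L[ℂ] 𝓢(Space n, ℂ) :=
  ∑ j, ((w j : ℝ) : ℂ) • position j

theorem linearMultiplier_apply (w : Space n) (u : 𝓢(Space n, ℂ)) (x : Space n) :
    linearMultiplier w u x = ((inner ℝ x w : ℝ) : ℂ) * u x := by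
  simp only [linearMultiplier, sum_apply, smul_apply,
    position_apply, PiLp.inner_apply, smul_eq_mul]
  push_cast
  rw [Finset.sum_mul]
  refine Finset.sum_congr rfl fun j _ => ?_
  simp
  ring

theorem linearMultiplier_pow_apply (w : Space n) (m : ℕ) (u : 𝓢(Space n, ℂ)) (x : Space n) :
    (linearMultiplier w ^ m) u x = ((inner ℝ x w : ℝ) : ℂ) ^ m * u x := by
  induction m with
  | zero => simp
  | succ m ih => rw [pow_succ', mul_apply_eq_comp, linearMultiplier_apply, ih, pow_succ']; ring

/-- Polynomials times the ground state are combinations of Hermite states, because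
`x_j = (raising + lowering) / 2`. -/
theorem linearMultiplier_pow_mem_span (ħ : ℝ) (hħ : 0 < ħ) (w : Space n) (m : ℕ) :
    (linearMultiplier w ^ m) (hermite ħ hħ 0)
      ∈ Submodule.span ℂ (Set.range (hermite ħ hħ : (Fin n → ℕ) → 𝓢(Space n, ℂ))) := by
  set V := Submodule.span ℂ (Set.range (hermite ħ hħ : (Fin n → ℕ) → 𝓢(Space n, ℂ)))
  have hb : ∀ k, hermite ħ hħ k ∈ V := fun k => Submodule.subset_span ⟨k, rfl⟩
  have hpos : ∀ j, ∀ u ∈ V, position j u ∈ V := by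
    intro j u hu
    induction hu using Submodule.span_induction with
    | mem u hu =>
      obtain ⟨k, rfl⟩ := hu
      have h1 : position j = (1 / 2 : ℂ) • (raising ħ j + lowering ħ j) := by
        simp only [raising, lowering]
        module
      rw [h1, smul_apply, add_apply]
      refine V.smul_mem _ (V.add_mem ?_ ?_)
      · rw [raising_hermite]
        exact V.smul_mem _ (hb _)
      · by_cases hk : k j = 0
        · rw [lowering_hermite_of_eq_zero ħ hħ hk]
          exact V.zero_mem
        · rw [← sub_single_add_single hk, lowering_hermite_add]
          exact V.smul_mem _ (hb _)
    | zero => simp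
    | add u v _ _ h1 h2 => rw [map_add]; exact V.add_mem h1 h2
    | smul c u _ h1 => rw [map_smul]; exact V.smul_mem _ h1
  induction m with
  | zero => exact hb 0
  | succ m ih =>
    rw [pow_succ', mul_apply_eq_comp]
    simp only [linearMultiplier, sum_apply, smul_apply]
    exact V.sum_mem fun j _ => V.smul_mem _ (hpos j _ ih)

theorem hermite_zero_apply (ħ : ℝ) (hħ : 0 < ħ) (x : Space n) :
    hermite ħ hħ 0 x = ((hermiteNorm ħ hħ (0 : Fin n → ℕ) : ℝ) : ℂ)⁻¹
      * ((Real.exp (-(1 / (2 * ħ)) * ‖x‖ ^ 2) : ℝ) : ℂ) := by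
  rw [hermite, hermiteRaw_zero, smul_apply, gaussian_apply, Complex.ofReal_exp, smul_eq_mul]

/-- A vector orthogonal to all Hermite states vanishes: by the exponential series, the Fourier
transform of its product with the ground state is zero. -/
theorem eq_zero_of_inner_hermite_eq_zero (ħ : ℝ) (hħ : 0 < ħ) (f : L2 n)
    (hf : ∀ k, inner ℂ ((hermite ħ hħ k).toLp 2 (volume : Measure (Space n))) f = 0) : f = 0 := by
  set u₀ : 𝓢(Space n, ℂ) := hermite ħ hħ 0 with hu₀
  have hspan : ∀ u ∈ Submodule.span ℂ (Set.range (hermite ħ hħ : (Fin n → ℕ) → 𝓢(Space n, ℂ))),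
      ∫ x, conj (u x) * f x = 0 := by
    intro u hu
    have h0 : inner ℂ (u.toLp 2) f = 0 := by
      induction hu using Submodule.span_induction with
      | mem u hu =>
        obtain ⟨k, rfl⟩ := hu
        exact hf k
      | zero => rw [toLp_zero, inner_zero_left]
      | add u v _ _ h1 h2 => rw [toLp_add, inner_add_left, h1, h2, add_zero]
      | smul c u _ h1 => rw [toLp_smul, inner_smul_left, h1, mul_zero]
    rw [← h0, L2.inner_def]
    refine integral_congr_ae ?_
    filter_upwards [u.coeFn_toLp 2 volume] with x hx
    rw [hx]
    simp [mul_comm]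
  have hmul : ∀ u : 𝓢(Space n, ℂ), Integrable fun x => ‖u x‖ * ‖f x‖ := fun u =>
    ((Lp.memLp f).norm.integrable_mul (u.memLp 2 volume).norm).congr
      (Filter.Eventually.of_forall fun x => by simp [mul_comm])
  have hint : Integrable fun x => u₀ x * f x :=
    (hmul u₀).mono (u₀.continuous.aestronglyMeasurable.mul (Lp.aestronglyMeasurable f))
      (Filter.Eventually.of_forall fun x => by simp)
  have hconj : ∀ x, conj (u₀ x) = u₀ x := by
    intro x
    rw [hu₀, hermite_zero_apply, ← Complex.ofReal_inv, ← Complex.ofReal_mul, Complex.conj_ofReal]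
  have hfour : ∀ w, FourierTransform.fourier (fun x => u₀ x * f x) w = 0 := by
    intro w
    rw [Real.fourier_eq']
    set g : Space n → ℝ := fun x => -2 * Real.pi * inner ℝ x w with hg
    -- Expand the exponential in a series and integrate term by term.
    have hlim : Filter.Tendsto
        (fun N : ℕ => ∫ x, (∑ m ∈ Finset.range N, (g x * Complex.I) ^ m / m.factorial)
          * (u₀ x * f x)) Filter.atTop
        (nhds (∫ x, Complex.exp (g x * Complex.I) * (u₀ x * f x))) := by
      -- `exp |g| ≤ C exp (‖x‖² / 4ħ)`, so half of the Gaussian decay is left.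
      set b : ℝ := 1 / (4 * ħ) with hb
      have hb0 : 0 < b := by positivity
      set c : ℝ := 2 * Real.pi * ‖w‖ with hc
      set K : ℝ := (hermiteNorm ħ hħ (0 : Fin n → ℕ))⁻¹ * Real.exp (c ^ 2 / (4 * b)) with hK
      have hbound : ∀ x, Real.exp |g x| * ‖u₀ x‖ ≤ K * ‖gaussian n b hb0 x‖ := by
        intro x
        have h1 : |g x| ≤ c * ‖x‖ := by
          rw [hg, hc]
          simp only [abs_mul, abs_neg, abs_two, abs_of_pos Real.pi_pos]
          have := abs_real_inner_le_norm x w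
          have h2 : 0 < 2 * Real.pi := by positivity
          nlinarith
        have h2 : c * ‖x‖ + -(1 / (2 * ħ)) * ‖x‖ ^ 2 ≤ c ^ 2 / (4 * b) + -b * ‖x‖ ^ 2 := by
          have h3 : c ^ 2 / (4 * b) - c * ‖x‖ + b * ‖x‖ ^ 2 = (c - 2 * b * ‖x‖) ^ 2 / (4 * b) := by
            field_simp
            ring
          have h4 : 0 ≤ (c - 2 * b * ‖x‖) ^ 2 / (4 * b) := by positivity
          have h5 : 1 / (2 * ħ) = 2 * b := by rw [hb]; field_simp; norm_num
          rw [h5]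
          linarith
        have hn := hermiteNorm_pos ħ hħ (0 : Fin n → ℕ)
        rw [hu₀, hermite_zero_apply, gaussian_apply, norm_mul, norm_inv, Complex.norm_real,
          Complex.norm_real, Complex.norm_exp, Complex.ofReal_re, Real.norm_of_nonneg hn.le,
          Real.norm_of_nonneg (Real.exp_pos _).le, hK, mul_left_comm, mul_assoc,
          ← Real.exp_add, ← Real.exp_add]
        exact mul_le_mul_of_nonneg_left (Real.exp_le_exp.mpr (by linarith)) (by positivity)
      refine tendsto_integral_of_dominated_convergence
        (fun x => K * (‖gaussian n b hb0 x‖ * ‖f x‖)) (fun N => ?_)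
        ((hmul (gaussian n b hb0)).const_mul K) (fun N => ?_) ?_
      · refine AEStronglyMeasurable.mul (Continuous.aestronglyMeasurable ?_)
          hint.aestronglyMeasurable
        fun_prop
      · refine Filter.Eventually.of_forall fun x => ?_
        have h1 : ‖∑ m ∈ Finset.range N, (g x * Complex.I) ^ m / (m.factorial : ℂ)‖
            ≤ Real.exp |g x| := by
          refine (norm_sum_le _ _).trans ?_
          have h2 : ∀ m : ℕ, ‖(g x * Complex.I) ^ m / (m.factorial : ℂ)‖
              = |g x| ^ m / m.factorial := by
            intro m
            simp
          simp only [h2]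
          exact Real.sum_le_exp_of_nonneg (abs_nonneg _) N
        calc _ ≤ Real.exp |g x| * (‖u₀ x‖ * ‖f x‖) := by
              rw [norm_mul, norm_mul]; gcongr
          _ = Real.exp |g x| * ‖u₀ x‖ * ‖f x‖ := by ring
          _ ≤ K * ‖gaussian n b hb0 x‖ * ‖f x‖ :=
              mul_le_mul_of_nonneg_right (hbound x) (norm_nonneg _)
          _ = _ := by ring
      · refine Filter.Eventually.of_forall fun x => Filter.Tendsto.mul_const _ ?_
        rw [Complex.exp_eq_exp_ℂ]
        exact (NormedSpace.expSeries_div_hasSum_exp (g x * Complex.I)).tendsto_sum_nat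
    have hzero : ∀ N : ℕ, ∫ x, (∑ m ∈ Finset.range N, (g x * Complex.I) ^ m / m.factorial)
          * (u₀ x * f x) = 0 := by
      intro N
      have hterm : ∀ x, (∑ m ∈ Finset.range N, (g x * Complex.I) ^ m / m.factorial)
          * (u₀ x * f x) = ∑ m ∈ Finset.range N,
            (((-2 * Real.pi : ℝ) * Complex.I) ^ m / m.factorial)
              * (conj ((linearMultiplier w ^ m) u₀ x) * f x) := by
        intro x
        rw [Finset.sum_mul]
        refine Finset.sum_congr rfl fun m _ => ?_
        rw [linearMultiplier_pow_apply, map_mul, map_pow, Complex.conj_ofReal, hconj, hg]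
        push_cast
        ring
      simp only [hterm]
      rw [integral_finsetSum]
      · refine Finset.sum_eq_zero fun m _ => ?_
        rw [integral_const_mul, hspan _ (linearMultiplier_pow_mem_span ħ hħ w m), mul_zero]
      · intro m _
        refine Integrable.const_mul ?_ _
        refine (hmul ((linearMultiplier w ^ m) u₀)).mono ?_
          (Filter.Eventually.of_forall fun x => by simp)
        exact (Complex.continuous_conj.comp
          (SchwartzMap.continuous _)).aestronglyMeasurable.mul (Lp.aestronglyMeasurable f)
    simp only [hzero] at hlim
    have := tendsto_nhds_unique hlim tendsto_const_nhds
    simpa [hg] using this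
  have hae := ae_eq_zero_of_fourier_eq_zero hint hfour
  rw [Lp.eq_zero_iff_ae_eq_zero]
  filter_upwards [hae] with x hx
  refine (mul_eq_zero.mp hx).resolve_left ?_
  rw [hu₀, hermite_zero_apply]
  have hn := hermiteNorm_pos ħ hħ (0 : Fin n → ℕ)
  exact mul_ne_zero (inv_ne_zero (by exact_mod_cast hn.ne'))
    (by exact_mod_cast (Real.exp_pos _).ne')

/-- The Hermite states form a Hilbert basis of `L²`. -/
noncomputable def hermiteBasis (n : ℕ) (ħ : ℝ) (hħ : 0 < ħ) :
    HilbertBasis (Fin n → ℕ) ℂ (L2 n) :=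
  HilbertBasis.mkOfOrthogonalEqBot (orthonormal_hermite ħ hħ) (by
    rw [Submodule.eq_bot_iff]
    intro f hf
    refine eq_zero_of_inner_hermite_eq_zero ħ hħ f fun k => ?_
    exact Submodule.mem_orthogonal _ _ |>.mp hf _ (Submodule.subset_span ⟨k, rfl⟩))

theorem hermiteBasis_apply (ħ : ℝ) (hħ : 0 < ħ) (k : Fin n → ℕ) :
    hermiteBasis n ħ hħ k = (hermite ħ hħ k).toLp 2 := by
  simp [hermiteBasis]

/-! ### Spectral measures with an eigenbasis -/

theorem hasSum_of_eq {ι M : Type*} [AddCommMonoid M] [TopologicalSpace M] {f g : ι → M} {a : M}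
    (h : HasSum f a) (e : ∀ k, g k = f k) : HasSum g a :=
  (funext e : g = f) ▸ h

namespace SpectralMeasure

variable {X : Type*} [MeasurableSpace X]
  {H : Type*} [NormedAddCommGroup H] [InnerProductSpace ℂ H] [CompleteSpace H]

theorem inner_proj_left (E : SpectralMeasure X H) {B : Set X} (hB : MeasurableSet B) (x y : H) :
    inner ℂ (E.proj B x) y = inner ℂ x (E.proj B y) := by
  have h := ContinuousLinearMap.adjoint_inner_left (E.proj B) y x
  rwa [← ContinuousLinearMap.star_eq_adjoint, (E.isStarProjection B hB).isSelfAdjoint.star_eq] at h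

theorem proj_proj (E : SpectralMeasure X H) {A B : Set X} (hA : MeasurableSet A)
    (hB : MeasurableSet B) (x : H) : E.proj A (E.proj B x) = E.proj (A ∩ B) x := by
  rw [E.proj_inter A B hA hB, mul_apply_eq_comp]

theorem inner_proj_eq (E : SpectralMeasure X H) {B : Set X} (hB : MeasurableSet B) (x : H) :
    inner ℂ x (E.proj B x) = ((‖E.proj B x‖ ^ 2 : ℝ) : ℂ) := by
  have h := E.inner_proj_left hB x (E.proj B x)
  rw [E.proj_proj hB hB, Set.inter_self, inner_self_eq_norm_sq_to_K] at h
  rw [← h]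
  norm_cast

theorem diag_apply (E : SpectralMeasure X H) {B : Set X} (hB : MeasurableSet B) (x : H) :
    E.diag x B = ENNReal.ofReal (‖E.proj B x‖ ^ 2) := by
  rw [diag, Measure.ofMeasurable_apply _ hB, E.inner_proj_eq hB, Complex.ofReal_re]

instance isFiniteMeasure_diag (E : SpectralMeasure X H) (x : H) : IsFiniteMeasure (E.diag x) :=
  ⟨by rw [E.diag_apply MeasurableSet.univ]; exact ENNReal.ofReal_lt_top⟩

theorem diag_real (E : SpectralMeasure X H) {B : Set X} (hB : MeasurableSet B) (x : H) :
    (E.diag x).real B = ‖E.proj B x‖ ^ 2 := by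
  rw [Measure.real, E.diag_apply hB, ENNReal.toReal_ofReal (by positivity)]

/-- The scalar spectral measure of `E(B) x + α x`. -/
theorem diag_proj_add_smul (E : SpectralMeasure X H) {B : Set X} (hB : MeasurableSet B) (x : H)
    (α : ℂ) : E.diag (E.proj B x + α • x)
      = ENNReal.ofReal (‖1 + α‖ ^ 2) • (E.diag x).restrict B
        + ENNReal.ofReal (‖α‖ ^ 2) • (E.diag x).restrict Bᶜ := by
  ext A hA
  have hAB := hA.inter hB
  have h1 : (E.diag x).real A = (E.diag x).real (A ∩ B) + (E.diag x).real (A ∩ Bᶜ) := by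
    rw [← Set.sdiff_eq]
    exact (measureReal_inter_add_sdiff hB).symm
  rw [E.diag_real hA, E.diag_real hAB] at h1
  have h2 : inner ℂ (E.proj B x + α • x) (E.proj A (E.proj B x + α • x))
      = (1 + α + conj α) * ((‖E.proj (A ∩ B) x‖ ^ 2 : ℝ) : ℂ)
        + conj α * α * ((‖E.proj A x‖ ^ 2 : ℝ) : ℂ) := by
    have e1 : inner ℂ (E.proj B x) (E.proj (A ∩ B) x) = ((‖E.proj (A ∩ B) x‖ ^ 2 : ℝ) : ℂ) := by
      rw [E.inner_proj_left hB, E.proj_proj hB hAB, Set.inter_comm, Set.inter_assoc,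
        Set.inter_self, E.inner_proj_eq hAB]
    have e2 : inner ℂ (E.proj B x) (E.proj A x) = ((‖E.proj (A ∩ B) x‖ ^ 2 : ℝ) : ℂ) := by
      rw [E.inner_proj_left hB, E.proj_proj hB hA, Set.inter_comm, E.inner_proj_eq hAB]
    rw [map_add, map_smul, E.proj_proj hA hB]
    simp only [inner_add_left, inner_add_right, inner_smul_left, inner_smul_right, e1, e2,
      E.inner_proj_eq hAB, E.inner_proj_eq hA]
    ring
  have h3 : ‖E.proj A (E.proj B x + α • x)‖ ^ 2
      = ‖1 + α‖ ^ 2 * ‖E.proj (A ∩ B) x‖ ^ 2 + ‖α‖ ^ 2 * (E.diag x).real (A ∩ Bᶜ) := by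
    rw [E.inner_proj_eq hA] at h2
    have h4 := congrArg Complex.re h2
    rw [h1] at h4
    have h5 : ((1 + α + conj α) * ((‖E.proj (A ∩ B) x‖ ^ 2 : ℝ) : ℂ)
        + conj α * α * ((‖E.proj (A ∩ B) x‖ ^ 2 + (E.diag x).real (A ∩ Bᶜ) : ℝ) : ℂ)).re
        = ‖1 + α‖ ^ 2 * ‖E.proj (A ∩ B) x‖ ^ 2 + ‖α‖ ^ 2 * (E.diag x).real (A ∩ Bᶜ) := by
      rw [← Complex.normSq_eq_norm_sq, ← Complex.normSq_eq_norm_sq, Complex.normSq_apply,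
        Complex.normSq_apply]
      simp only [Complex.add_re, Complex.mul_re, Complex.ofReal_re, Complex.ofReal_im,
        Complex.add_im, Complex.mul_im, Complex.conj_re, Complex.conj_im, Complex.one_re,
        Complex.one_im]
      ring
    rw [h5] at h4
    exact h4
  rw [E.diag_apply hA, h3, Measure.add_apply, Measure.smul_apply, Measure.smul_apply,
    Measure.restrict_apply hA, Measure.restrict_apply hA, smul_eq_mul, smul_eq_mul,
    ENNReal.ofReal_add (by positivity) (by positivity), ENNReal.ofReal_mul (by positivity),
    ENNReal.ofReal_mul (by positivity), ofReal_measureReal, E.diag_apply hAB]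

/-- By `diag_proj_add_smul` with `α = ±1, ±i`, the polarization formula collapses to an integral
over `B`. -/
theorem sesq_proj (E : SpectralMeasure X H) {B : Set X} (hB : MeasurableSet B) (x : H)
    {f : X → ℂ} (hf : Integrable f (E.diag x)) :
    E.sesq f (E.proj B x) x = ∫ t in B, f t ∂(E.diag x) := by
  have h : ∀ α : ℂ, ∫ t, f t ∂(E.diag (E.proj B x + α • x))
      = (‖1 + α‖ ^ 2 : ℝ) * (∫ t in B, f t ∂(E.diag x))
        + (‖α‖ ^ 2 : ℝ) * (∫ t in Bᶜ, f t ∂(E.diag x)) := by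
    intro α
    rw [E.diag_proj_add_smul hB, integral_add_measure
      (hf.integrableOn.smul_measure ENNReal.ofReal_ne_top)
      (hf.integrableOn.smul_measure ENNReal.ofReal_ne_top), integral_smul_measure,
      integral_smul_measure, ENNReal.toReal_ofReal (by positivity),
      ENNReal.toReal_ofReal (by positivity), Complex.real_smul, Complex.real_smul]
  have h1 := h 1
  have h2 := h (-1)
  have h3 := h Complex.I
  have h4 := h (-Complex.I)
  have n1 : ‖(1 : ℂ) + Complex.I‖ ^ 2 = 2 := by
    rw [← Complex.normSq_eq_norm_sq, Complex.normSq_apply]; norm_num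
  have n2 : ‖(1 : ℂ) + -Complex.I‖ ^ 2 = 2 := by
    rw [← Complex.normSq_eq_norm_sq, Complex.normSq_apply]; norm_num
  have n3 : ‖(1 : ℂ) + 1‖ ^ 2 = 4 := by
    rw [← Complex.normSq_eq_norm_sq, Complex.normSq_apply]; norm_num
  rw [one_smul, n3] at h1
  rw [neg_one_smul, ← sub_eq_add_neg] at h2
  rw [n1] at h3
  rw [n2, neg_smul, ← sub_eq_add_neg] at h4
  rw [sesq, h1, h2, h3, h4]
  simp

/-- If `x` is an eigenvector of `∫ f dE`, its scalar spectral measure lives on the level set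
of `f`: testing the eigenvalue equation against `E(B) x` gives `∫_B (f - c) = 0` for all `B`. -/
theorem HasIntegral.ae_eq_of_eigenvector {E : SpectralMeasure X H} {x : H} {f : X → ℂ} {c : ℂ}
    (h : E.HasIntegral f x (c • x)) : ∀ᵐ t ∂(E.diag x), f t = c := by
  have hf : Integrable f (E.diag x) := h.1.integrable (by norm_num)
  have h1 := (hf.sub (integrable_const c)).ae_eq_zero_of_forall_setIntegral_eq_zero
    fun B hB _ => by
      have h2 : MemLp f 2 (E.diag (E.proj B x)) := by
        have h3 := E.diag_proj_add_smul hB x 0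
        simp only [zero_smul, add_zero, norm_one, one_pow, ENNReal.ofReal_one, one_smul, norm_zero]
          at h3
        rw [h3]
        simpa using h.1.restrict B
      have h4 := h.2 _ h2
      rw [E.sesq_proj hB x hf, inner_smul_right, E.inner_proj_left hB, E.inner_proj_eq hB,
        ← E.diag_real hB] at h4
      simp only [Pi.sub_apply]
      rw [integral_sub hf.integrableOn (integrable_const c).integrableOn, ← h4, setIntegral_const,
        Complex.real_smul, mul_comm, sub_self]
  filter_upwards [h1] with t ht
  exact sub_eq_zero.mp ht

variable {ι : Type*} (b : HilbertBasis ι ℂ H) (pt : ι → X)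

/-- The spectral measure `E` is diagonal in the basis `b`, the vector `b k` sitting at the
point `pt k`. -/
def IsDiagonal (E : SpectralMeasure X H) : Prop :=
  ∀ B, MeasurableSet B → ∀ k, E.proj B (b k) = B.indicator (fun _ => b k) (pt k)

variable {b pt}

/-- A basis vector whose scalar spectral measure lives at a single point is fixed or killed by
all projections. -/
theorem proj_eq_indicator_of_ae_eq (E : SpectralMeasure X H) {x : H} {p : X}
    (h : ∀ᵐ t ∂(E.diag x), t = p) {B : Set X} (hB : MeasurableSet B) :
    E.proj B x = B.indicator (fun _ => x) p := by
  by_cases hp : p ∈ B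
  · rw [Set.indicator_of_mem hp]
    have h1 : E.diag x B = E.diag x Set.univ := by
      refine measure_congr ?_
      filter_upwards [h] with t ht
      exact propext ⟨fun _ => trivial, fun _ => ht.symm ▸ hp⟩
    have h2 : ‖E.proj B x‖ ^ 2 = ‖x‖ ^ 2 := by
      have h3 : (E.diag x).real B = (E.diag x).real Set.univ := congrArg ENNReal.toReal h1
      rwa [E.diag_real hB, E.diag_real MeasurableSet.univ, E.proj_univ, one_apply_eq_self] at h3
    have h4 : ‖x - E.proj B x‖ ^ 2 = 0 := by
      rw [@norm_sub_sq ℂ, E.inner_proj_eq hB, h2]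
      simp only [RCLike.re_to_complex, Complex.ofReal_re]
      ring
    exact (sub_eq_zero.mp (norm_eq_zero.mp (pow_eq_zero_iff two_ne_zero |>.mp h4))).symm
  · rw [Set.indicator_of_notMem hp]
    have h1 : E.diag x B = 0 := by
      rw [measure_eq_zero_iff_ae_notMem]
      filter_upwards [h] with t ht
      exact ht.symm ▸ hp
    have h2 := E.diag_real hB x
    rw [Measure.real, h1, ENNReal.toReal_zero] at h2
    exact norm_eq_zero.mp (pow_eq_zero_iff two_ne_zero |>.mp h2.symm)

theorem IsDiagonal.inner_proj {E : SpectralMeasure X H} (hE : E.IsDiagonal b pt) {B : Set X}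
    (hB : MeasurableSet B) (k : ι) (x : H) :
    inner ℂ (b k) (E.proj B x) = B.indicator (fun _ => inner ℂ (b k) x) (pt k) := by
  rw [← E.inner_proj_left hB, hE B hB k]
  by_cases h : pt k ∈ B <;> simp [h]

theorem IsDiagonal.diag_eq {E : SpectralMeasure X H} (hE : E.IsDiagonal b pt) (x : H) :
    E.diag x = Measure.sum fun k =>
      ENNReal.ofReal (‖(inner ℂ (b k) x : ℂ)‖ ^ 2) • Measure.dirac (pt k) := by
  ext B hB
  have h1 := b.hasSum_inner_mul_inner x (E.proj B x)
  have h2 : ∀ k, inner ℂ x (b k) * inner ℂ (b k) (E.proj B x)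
      = ((B.indicator (fun _ => ‖(inner ℂ (b k) x : ℂ)‖ ^ 2) (pt k) : ℝ) : ℂ) := by
    intro k
    rw [hE.inner_proj hB]
    by_cases h : pt k ∈ B
    · rw [Set.indicator_of_mem h, Set.indicator_of_mem h, ← inner_conj_symm x, Complex.conj_mul']
      norm_cast
    · simp [h]
  simp only [h2, E.inner_proj_eq hB] at h1
  have h3 := Complex.hasSum_ofReal.mp h1
  rw [E.diag_apply hB, ← h3.tsum_eq, ENNReal.ofReal_tsum_of_nonneg
    (fun k => Set.indicator_nonneg (fun _ _ => by positivity) _) h3.summable,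
    Measure.sum_apply _ hB]
  congr 1 with k
  rw [Measure.smul_apply, Measure.dirac_apply' _ hB]
  by_cases h : pt k ∈ B <;> simp [h]

/-- Any family of points carries a diagonal spectral measure: the projection attached to `B` is the
one onto the orthogonal complement of the vectors `b k` with `pt k ∉ B`. -/
theorem IsDiagonal.exists (b : HilbertBasis ι ℂ H) (pt : ι → X) :
    ∃ E : SpectralMeasure X H, E.IsDiagonal b pt := by
  classical
  set K : Set X → Submodule ℂ H := fun B => (Submodule.span ℂ (b '' {k | pt k ∉ B}))ᗮ with hK
  have hmem : ∀ B x, x ∈ K B ↔ ∀ k, pt k ∉ B → inner ℂ (b k) x = 0 := by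
    intro B x
    rw [hK, Submodule.mem_orthogonal]
    constructor
    · exact fun h k hk => h _ (Submodule.subset_span ⟨k, hk, rfl⟩)
    · intro h u hu
      induction hu using Submodule.span_induction with
      | mem u hu => obtain ⟨k, hk, rfl⟩ := hu; exact h k hk
      | zero => exact inner_zero_left _
      | add u v _ _ h1 h2 => rw [inner_add_left, h1, h2, add_zero]
      | smul c u _ h1 => rw [inner_smul_left, h1, mul_zero]
  have hcoef : ∀ B x k, inner ℂ (b k) ((K B).starProjection x)
      = B.indicator (fun _ => (inner ℂ (b k) x : ℂ)) (pt k) := by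
    intro B x k
    by_cases hk : pt k ∈ B
    · have hb : b k ∈ K B := (hmem B _).mpr fun l hl => b.orthonormal.2 (by rintro rfl; exact hl hk)
      rw [Set.indicator_of_mem hk, ← Submodule.inner_starProjection_left_eq_right,
        Submodule.starProjection_eq_self_iff.mpr hb]
    · rw [Set.indicator_of_notMem hk]
      exact (hmem B _).mp (Submodule.starProjection_apply_mem _ _) k hk
  have hext : ∀ x y : H, (∀ k, (inner ℂ (b k) x : ℂ) = inner ℂ (b k) y) → x = y := by
    intro x y h
    apply b.repr.injective
    ext k
    rw [b.repr_apply_apply, b.repr_apply_apply, h]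
  refine ⟨⟨fun B => (K B).starProjection, fun B _ => isStarProjection_starProjection, ?_, ?_, ?_⟩,
    fun B _ k => ?_⟩
  · ext x
    refine hext _ _ fun k => ?_
    simp [hcoef]
  · intro A B _ _
    ext x
    refine hext _ _ fun k => ?_
    rw [mul_apply_eq_comp, hcoef, hcoef]
    by_cases h1 : pt k ∈ A
    · rw [Set.indicator_of_mem h1, hcoef]
      by_cases h2 : pt k ∈ B <;> simp [h1, h2]
    · simp [h1]
  · intro B _ hd x
    have hser : ∀ A : Set X, HasSum (fun k => A.indicator (fun _ => (inner ℂ (b k) x : ℂ)) (pt k)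
        • b k) ((K A).starProjection x) := by
      intro A
      have h := b.hasSum_repr ((K A).starProjection x)
      simpa only [b.repr_apply_apply, hcoef] using h
    -- Each index `k` is sent to the unique pair `(i, k)` with `pt k ∈ B i`.
    set idx : ι → ℕ := fun k => if h : ∃ i, pt k ∈ B i then h.choose else 0 with hidx
    have hidx' : ∀ k i, pt k ∈ B i → idx k = i := by
      intro k i hi
      have hex : ∃ i, pt k ∈ B i := ⟨i, hi⟩
      by_contra hne
      rw [hidx] at hne
      simp only [hex, dif_pos] at hne
      exact Set.disjoint_left.mp (hd hne) hex.choose_spec hi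
    have hinj : Function.Injective fun k => (idx k, k) := fun k l h => (Prod.ext_iff.mp h).2
    have hpair : HasSum (fun q : ℕ × ι =>
        (B q.1).indicator (fun _ => (inner ℂ (b q.2) x : ℂ)) (pt q.2) • b q.2)
        ((K (⋃ i, B i)).starProjection x) := by
      rw [← hinj.hasSum_iff]
      · refine hasSum_of_eq (hser (⋃ i, B i)) fun k => ?_
        by_cases hk : ∃ i, pt k ∈ B i
        · obtain ⟨i, hi⟩ := hk
          simp only [Function.comp_apply]
          rw [hidx' k i hi, Set.indicator_of_mem hi,
            Set.indicator_of_mem (Set.mem_iUnion.mpr ⟨i, hi⟩)]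
        · have h1 : pt k ∉ ⋃ i, B i := fun h => hk (Set.mem_iUnion.mp h)
          simp only [Function.comp_apply]
          rw [Set.indicator_of_notMem h1, Set.indicator_of_notMem fun h => hk ⟨_, h⟩]
      · rintro ⟨i, k⟩ hik
        have : pt k ∉ B i := fun h => hik ⟨k, by simp [hidx' k i h]⟩
        simp [this]
    exact hpair.prod_fiberwise fun i => hser (B i)
  · refine hext _ _ fun l => ?_
    change inner ℂ (b l) ((K B).starProjection (b k)) = _
    rw [hcoef]
    by_cases hlk : l = k
    · subst hlk
      by_cases hk : pt l ∈ B <;> simp [hk]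
    · have h0 : (inner ℂ (b l) (b k) : ℂ) = 0 := b.orthonormal.2 hlk
      by_cases hk : pt k ∈ B <;> simp [hk, h0]

variable [Countable ι] [MeasurableSingletonClass X]

theorem IsDiagonal.memLp_iff {E : SpectralMeasure X H} (hE : E.IsDiagonal b pt) {f : X → ℂ}
    (hf : Measurable f) (x : H) :
    MemLp f 2 (E.diag x) ↔ Summable fun k => ‖f (pt k) * inner ℂ (b k) x‖ ^ 2 := by
  rw [memLp_two_iff_integrable_sq_norm hf.aestronglyMeasurable, hE.diag_eq,
    integrable_sum_dirac_iff fun _ => ENNReal.ofReal_ne_top]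
  refine summable_congr fun k => ?_
  rw [ENNReal.toReal_ofReal (by positivity), Real.norm_of_nonneg (by positivity), norm_mul]
  ring

/-- The polarized integral `⟨z, (∫ f dE) x⟩` in coordinates. -/
theorem IsDiagonal.hasSum_sesq {E : SpectralMeasure X H} (hE : E.IsDiagonal b pt) {f : X → ℂ}
    (hf : Measurable f) {z x : H} (hz : MemLp f 2 (E.diag z)) (hx : MemLp f 2 (E.diag x)) :
    HasSum (fun k => inner ℂ z (b k) * (f (pt k) * inner ℂ (b k) x)) (E.sesq f z x) := by
  have h : ∀ α : ℂ, HasSum (fun k => (‖(inner ℂ (b k) z + α * inner ℂ (b k) x : ℂ)‖ ^ 2 : ℝ)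
      * f (pt k)) (∫ t, f t ∂(E.diag (z + α • x))) := by
    intro α
    have h1 : MemLp f 2 (E.diag (z + α • x)) := by
      rw [hE.memLp_iff hf] at hz hx ⊢
      refine Summable.of_nonneg_of_le (fun k => by positivity) (fun k => ?_)
        ((hz.mul_left 2).add (hx.mul_left (2 * ‖α‖ ^ 2)))
      rw [inner_add_right, inner_smul_right]
      calc ‖f (pt k) * (inner ℂ (b k) z + α * inner ℂ (b k) x)‖ ^ 2
          ≤ (‖f (pt k) * inner ℂ (b k) z‖ + ‖α‖ * ‖f (pt k) * inner ℂ (b k) x‖) ^ 2 := by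
            gcongr
            rw [← norm_mul, mul_add, mul_left_comm (f (pt k)) α]
            exact norm_add_le _ _
        _ ≤ _ := by
            nlinarith [sq_nonneg (‖f (pt k) * inner ℂ (b k) z‖
              - ‖α‖ * ‖f (pt k) * inner ℂ (b k) x‖)]
    have h2 : Integrable f (E.diag (z + α • x)) := h1.integrable (by norm_num)
    rw [hE.diag_eq] at h2 ⊢
    have h3 := hasSum_integral_sum_dirac (fun _ => ENNReal.ofReal_ne_top) h2.summable_of_dirac
    refine hasSum_of_eq h3 fun k => ?_
    rw [ENNReal.toReal_ofReal (by positivity), inner_add_right, inner_smul_right,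
      Complex.real_smul]
  have h1 := h 1
  have h2 := h (-1)
  have h3 := h Complex.I
  have h4 := h (-Complex.I)
  rw [one_smul] at h1
  rw [neg_one_smul, ← sub_eq_add_neg] at h2
  rw [neg_smul, ← sub_eq_add_neg] at h4
  have h5 := ((h1.sub h2).add ((h4.sub h3).mul_right Complex.I)).div_const 4
  rw [sesq]
  refine hasSum_of_eq h5 fun k => ?_
  rw [← inner_conj_symm z (b k)]
  generalize (inner ℂ (b k) z : ℂ) = p
  generalize (inner ℂ (b k) x : ℂ) = q
  have hn : ∀ w : ℂ, ((‖w‖ ^ 2 : ℝ) : ℂ) = conj w * w := fun w => by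
    rw [Complex.conj_mul']; norm_cast
  simp only [hn, map_add, map_mul, map_neg, map_one, Complex.conj_I]
  linear_combination (f (pt k) * conj p * q / 2 - f (pt k) * conj q * p / 2) * Complex.I_sq

/-- In an eigenbasis, `∫ f dE` is multiplication by the values of `f`. The domain condition is
implied by the equation for the coefficients, as `y` is square-summable. -/
theorem IsDiagonal.hasIntegral_iff {E : SpectralMeasure X H} (hE : E.IsDiagonal b pt) {f : X → ℂ}
    (hf : Measurable f) (x y : H) :
    E.HasIntegral f x y ↔ ∀ k, inner ℂ (b k) y = f (pt k) * inner ℂ (b k) x := by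
  classical
  constructor
  · rintro ⟨hx, h⟩ k
    have hk : MemLp f 2 (E.diag (b k)) := by
      rw [hE.memLp_iff hf]
      refine summable_of_ne_finset_zero (s := {k}) fun l hl => ?_
      rw [Finset.mem_singleton] at hl
      rw [b.orthonormal.2 hl]
      simp
    have h1 := hE.hasSum_sesq hf hk hx
    rw [← h _ hk] at h1
    have h2 : HasSum (fun l => inner ℂ (b k) (b l) * (f (pt l) * inner ℂ (b l) x))
        (inner ℂ (b k) (b k) * (f (pt k) * inner ℂ (b k) x)) :=
      hasSum_single k fun l hl => by rw [b.orthonormal.2 hl.symm, zero_mul]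
    rw [h1.unique h2, inner_self_eq_norm_sq_to_K, b.orthonormal.1 k]
    simp
  · intro h
    have hx : MemLp f 2 (E.diag x) := by
      rw [hE.memLp_iff hf]
      simp only [← h]
      have h1 := (b.summable_inner_mul_inner y y).norm
      refine h1.congr fun k => ?_
      rw [norm_mul, ← inner_conj_symm y, RCLike.norm_conj, sq]
    refine ⟨hx, fun z hz => ?_⟩
    have h1 := hE.hasSum_sesq hf hz hx
    simp only [← h] at h1
    exact (b.hasSum_inner_mul_inner z y).unique h1

end SpectralMeasure

/-! ### The joint spectral measure of the oscillators -/

variable {ħ : ℝ}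

theorem inner_hermiteBasis_oscillator (hħ : 0 < ħ) (i : Fin n) (u : 𝓢(Space n, ℂ))
    (k : Fin n → ℕ) : inner ℂ (hermiteBasis n ħ hħ k) ((oscillator ħ i u).toLp 2)
      = ((level ħ k i : ℝ) : ℂ) * inner ℂ (hermiteBasis n ħ hħ k) (u.toLp 2) := by
  have h := ip_oscillator ħ i (hermite ħ hħ k) u
  rw [oscillator_hermite, ip_smul_left, Complex.conj_ofReal] at h
  rw [hermiteBasis_apply]
  exact h.symm

theorem measurable_coord (i : Fin n) : Measurable fun t : Space n => ((t i : ℝ) : ℂ) :=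
  (hasTemperateGrowth_coord i).1.continuous.measurable

/-- The joint spectral measures of the oscillators are those which are diagonal in the Hermite
basis, the state `k` sitting at the point `(k + 1/2) ħ`: this state is an eigenvector of every
coordinate integral, so its scalar spectral measure is concentrated at that point. -/
theorem isJointSpectralMeasure_iff (hħ : 0 < ħ) (E : SpectralMeasure (Space n) (L2 n)) :
    IsJointSpectralMeasure ħ E ↔ E.IsDiagonal (hermiteBasis n ħ hħ) (level ħ) := by
  constructor
  · intro hE B hB k
    refine E.proj_eq_indicator_of_ae_eq ?_ hB
    have h : ∀ i : Fin n, ∀ᵐ t ∂(E.diag (hermiteBasis n ħ hħ k)),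
        ((t i : ℝ) : ℂ) = ((level ħ k i : ℝ) : ℂ) := by
      intro i
      have h1 := hE i (hermite ħ hħ k)
      rw [oscillator_hermite, toLp_smul, ← hermiteBasis_apply] at h1
      exact h1.ae_eq_of_eigenvector
    filter_upwards [ae_all_iff.mpr h] with t ht
    ext i
    exact_mod_cast ht i
  · intro hE i u
    rw [hE.hasIntegral_iff (measurable_coord i)]
    exact inner_hermiteBasis_oscillator hħ i u

/-- `h(P)` multiplies the Hermite coefficients by the values of `h` at the levels. -/
theorem functionOfOscillators_iff (hħ : 0 < ħ) {h : Space n → ℂ} (hh : Measurable h)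
    (x y : L2 n) : FunctionOfOscillators ħ h x y ↔
      ∀ k, inner ℂ (hermiteBasis n ħ hħ k) y
        = h (level ħ k) * inner ℂ (hermiteBasis n ħ hħ k) x := by
  constructor
  · rintro ⟨E, hE, hxy⟩
    rw [isJointSpectralMeasure_iff hħ] at hE
    exact (hE.hasIntegral_iff hh x y).mp hxy
  · intro hxy
    obtain ⟨E, hE⟩ := SpectralMeasure.IsDiagonal.exists (hermiteBasis n ħ hħ) (level ħ)
    exact ⟨E, (isJointSpectralMeasure_iff hħ E).mpr hE, (hE.hasIntegral_iff hh x y).mpr hxy⟩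

/-! ### The Wigner function as a partial Fourier transform -/

/-- The Schwartz function `y ↦ u (x + c y)`, for `c ≠ 0`. -/
noncomputable def affineComp (c : ℝ) (hc : c ≠ 0) (x : Space n) :
    𝓢(Space n, ℂ) →L[ℂ] 𝓢(Space n, ℂ) :=
  (SchwartzMap.compCLMOfContinuousLinearEquiv ℂ
    (ContinuousLinearEquiv.smulLeft (R₁ := ℝ) (M₁ := Space n) (Units.mk0 c hc))).comp
      (SchwartzMap.compSubConstCLM ℂ (-x))

theorem affineComp_apply (c : ℝ) (hc : c ≠ 0) (x : Space n) (u : 𝓢(Space n, ℂ)) (y : Space n) :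
    affineComp c hc x u y = u (x + c • y) := by
  simp [affineComp, add_comm, Units.smul_def]

/-- The Schwartz function `y ↦ u (x + y/2) conj (v (x - y/2))`, whose Fourier transform is the
Wigner function over the point `x`. -/
noncomputable def wignerSlice (u v : 𝓢(Space n, ℂ)) (x : Space n) : 𝓢(Space n, ℂ) :=
  SchwartzMap.pairing (ContinuousLinearMap.mul ℝ ℂ)
    (affineComp (1 / 2) (by norm_num) x u)
    (SchwartzMap.postcompCLM (𝕜 := ℝ) (Complex.conjCLE : ℂ →L[ℝ] ℂ)
      (affineComp (-(1 / 2)) (by norm_num) x v))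

theorem wignerSlice_apply (u v : 𝓢(Space n, ℂ)) (x y : Space n) :
    wignerSlice u v x y = u (x + (1 / 2 : ℝ) • y) * conj (v (x - (1 / 2 : ℝ) • y)) := by
  simp [wignerSlice, affineComp_apply, sub_eq_add_neg]

theorem wigner_eq_fourier (ħ : ℝ) (u v : 𝓢(Space n, ℂ)) (z : Space n × Space n) :
    wigner ħ u v z = ((2 * Real.pi * ħ : ℝ) : ℂ)⁻¹ ^ n
      * FourierTransform.fourier (wignerSlice u v z.1) ((2 * Real.pi * ħ)⁻¹ • z.2) := by
  rw [wigner, SchwartzMap.fourier_coe, Real.fourier_eq']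
  congr 1
  refine integral_congr_ae (Filter.Eventually.of_forall fun y => ?_)
  simp only [wignerSlice_apply, smul_eq_mul, ← mul_assoc]
  congr 3
  rw [inner_smul_right]
  have : (-2 * Real.pi * ((2 * Real.pi * ħ)⁻¹ * inner ℝ y z.2) : ℝ) = -(inner ℝ y z.2 / ħ) := by
    have := Real.pi_ne_zero
    rw [mul_inv, mul_inv]
    field_simp
  rw [this]
  push_cast
  ring

/-- The value at `z = (x, ξ)` of the Wigner function as a linear functional of the slice over
`x`. -/
noncomputable def sliceTransform (ħ : ℝ) (z : Space n × Space n) : 𝓢(Space n, ℂ) →ₗ[ℂ] ℂ where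
  toFun s := ((2 * Real.pi * ħ : ℝ) : ℂ)⁻¹ ^ n
      * FourierTransform.fourier s ((2 * Real.pi * ħ)⁻¹ • z.2)
  map_add' s t := by
    rw [FourierTransform.fourier_add, add_apply, mul_add]
  map_smul' c s := by
    rw [FourierTransform.fourier_smul, smul_apply, smul_eq_mul, smul_eq_mul, RingHom.id_apply]
    ring

theorem wigner_eq_sliceTransform (ħ : ℝ) (u v : 𝓢(Space n, ℂ)) (z : Space n × Space n) :
    wigner ħ u v z = sliceTransform ħ z (wignerSlice u v z.1) := wigner_eq_fourier ħ u v z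

theorem wigner_add_left (ħ : ℝ) (u u' v : 𝓢(Space n, ℂ)) (z : Space n × Space n) :
    wigner ħ (u + u') v z = wigner ħ u v z + wigner ħ u' v z := by
  simp only [wigner_eq_sliceTransform, ← map_add]
  congr 1
  ext y
  simp only [wignerSlice_apply, add_apply]
  ring

theorem wigner_add_right (ħ : ℝ) (u v v' : 𝓢(Space n, ℂ)) (z : Space n × Space n) :
    wigner ħ u (v + v') z = wigner ħ u v z + wigner ħ u v' z := by
  simp only [wigner_eq_sliceTransform, ← map_add]
  congr 1
  ext y
  simp only [wignerSlice_apply, add_apply, map_add]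
  ring

theorem wigner_smul_left (ħ : ℝ) (c : ℂ) (u v : 𝓢(Space n, ℂ)) (z : Space n × Space n) :
    wigner ħ (c • u) v z = c * wigner ħ u v z := by
  simp only [wigner_eq_sliceTransform]
  rw [← smul_eq_mul, ← map_smul]
  congr 1
  ext y
  simp only [wignerSlice_apply, smul_apply, smul_eq_mul]
  ring

theorem wigner_smul_right (ħ : ℝ) (c : ℂ) (u v : 𝓢(Space n, ℂ)) (z : Space n × Space n) :
    wigner ħ u (c • v) z = conj c * wigner ħ u v z := by
  simp only [wigner_eq_sliceTransform]
  rw [← smul_eq_mul, ← map_smul]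
  congr 1
  ext y
  simp only [wignerSlice_apply, smul_apply, smul_eq_mul, map_mul]
  ring

theorem wigner_zero_left (ħ : ℝ) (v : 𝓢(Space n, ℂ)) (z : Space n × Space n) :
    wigner ħ 0 v z = 0 := by
  simpa using wigner_smul_left ħ 0 0 v z

theorem wigner_sub_left (ħ : ℝ) (u u' v : 𝓢(Space n, ℂ)) (z : Space n × Space n) :
    wigner ħ (u - u') v z = wigner ħ u v z - wigner ħ u' v z := by
  have h : u - u' = u + (-1 : ℂ) • u' := by module
  rw [h, wigner_add_left, wigner_smul_left]
  ring

theorem wigner_sub_right (ħ : ℝ) (u v v' : 𝓢(Space n, ℂ)) (z : Space n × Space n) :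
    wigner ħ u (v - v') z = wigner ħ u v z - wigner ħ u v' z := by
  have h : v - v' = v + (-1 : ℂ) • v' := by module
  rw [h, wigner_add_right, wigner_smul_right]
  simp
  ring

/-! ### Multiplication of Wigner functions by the phase space coordinates -/

theorem coord_mul_wigner (ħ : ℝ) (j : Fin n) (u v : 𝓢(Space n, ℂ)) (z : Space n × Space n) :
    (z.1 j : ℂ) * wigner ħ u v z
      = (wigner ħ (position j u) v z + wigner ħ u (position j v) z) / 2 := by
  have h : wignerSlice (position j u) v z.1 + wignerSlice u (position j v) z.1
      = (2 * (z.1 j : ℂ)) • wignerSlice u v z.1 := by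
    ext y
    simp only [wignerSlice_apply, position_apply, add_apply, smul_apply, smul_eq_mul, map_mul,
      Complex.conj_ofReal, PiLp.add_apply, PiLp.sub_apply, PiLp.smul_apply]
    push_cast
    ring
  simp only [wigner_eq_sliceTransform, ← map_add]
  rw [h, map_smul, smul_eq_mul]
  ring

/-- The variable `y` enters the slice through `y / 2` and `-y / 2`, whence the factor and the
sign. -/
theorem partialDeriv_wignerSlice (j : Fin n) (u v : 𝓢(Space n, ℂ)) (x : Space n) :
    partialDeriv j (wignerSlice u v x) = (1 / 2 : ℂ) •
      (wignerSlice (partialDeriv j u) v x - wignerSlice u (partialDeriv j v) x) := by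
  ext y
  have hlin : ∀ c : ℝ, HasFDerivAt (fun y : Space n => x + c • y)
      (c • ContinuousLinearMap.id ℝ (Space n)) y := fun c =>
    ((hasFDerivAt_id y).const_smul c).const_add x
  have hu : HasFDerivAt (fun y : Space n => u (x + (1 / 2 : ℝ) • y)) _ y :=
    (u.hasFDerivAt _).comp y (hlin (1 / 2))
  have hv : HasFDerivAt (fun y : Space n => conj (v (x - (1 / 2 : ℝ) • y)))
      ((Complex.conjCLE : ℂ →L[ℝ] ℂ).comp ((fderiv ℝ v (x - (1 / 2 : ℝ) • y)).comp
        (-(1 / 2 : ℝ) • ContinuousLinearMap.id ℝ (Space n)))) y := by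
    have h1 := hlin (-(1 / 2))
    simp only [neg_smul, ← sub_eq_add_neg] at h1 ⊢
    exact (Complex.conjCLE : ℂ →L[ℝ] ℂ).hasFDerivAt.comp y ((v.hasFDerivAt _).comp y h1)
  have huv : HasFDerivAt (fun y : Space n => u (x + (1 / 2 : ℝ) • y)
      * conj (v (x - (1 / 2 : ℝ) • y))) _ y := hu.mul hv
  have hfun : (⇑(wignerSlice u v x) : Space n → ℂ)
      = fun y => u (x + (1 / 2 : ℝ) • y) * conj (v (x - (1 / 2 : ℝ) • y)) :=
    funext (wignerSlice_apply u v x)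
  simp only [partialDeriv_apply, smul_apply, sub_apply, wignerSlice_apply, hfun, huv.fderiv]
  simp
  ring

theorem fourier_partialDeriv (j : Fin n) (s : 𝓢(Space n, ℂ)) (w : Space n) :
    FourierTransform.fourier (partialDeriv j s) w
      = 2 * Real.pi * Complex.I * (w j : ℂ) * FourierTransform.fourier s w := by
  have hg : (fun x : Space n => inner ℝ x (EuclideanSpace.single j (1 : ℝ))).HasTemperateGrowth :=
    ((innerSL ℝ).flip (EuclideanSpace.single j (1 : ℝ))).hasTemperateGrowth
  have h := congrArg (fun f : 𝓢(Space n, ℂ) => f w)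
    (SchwartzMap.fourier_lineDerivOp_eq s (EuclideanSpace.single j (1 : ℝ)))
  simp only [smul_apply, SchwartzMap.smulLeftCLM_apply_apply hg] at h
  refine h.trans ?_
  simp [EuclideanSpace.inner_single_right]
  ring

theorem momentum_mul_wigner {ħ : ℝ} (hħ : 0 < ħ) (j : Fin n) (u v : 𝓢(Space n, ℂ))
    (z : Space n × Space n) : (z.2 j : ℂ) * wigner ħ u v z = -(Complex.I * ħ / 2) *
      (wigner ħ (partialDeriv j u) v z - wigner ħ u (partialDeriv j v) z) := by
  have h1 : sliceTransform ħ z (partialDeriv j (wignerSlice u v z.1))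
      = Complex.I / ħ * (z.2 j : ℂ) * wigner ħ u v z := by
    have hpi : (Real.pi : ℂ) ≠ 0 := by exact_mod_cast Real.pi_ne_zero
    have hħ' : (ħ : ℂ) ≠ 0 := by exact_mod_cast hħ.ne'
    rw [wigner_eq_sliceTransform]
    simp only [sliceTransform, LinearMap.coe_mk, AddHom.coe_mk, fourier_partialDeriv,
      PiLp.smul_apply, smul_eq_mul]
    push_cast
    field_simp
  rw [partialDeriv_wignerSlice, map_smul, map_sub, ← wigner_eq_sliceTransform,
    ← wigner_eq_sliceTransform, smul_eq_mul] at h1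
  have hħ' : (ħ : ℂ) ≠ 0 := by exact_mod_cast hħ.ne'
  have h2 : (z.2 j : ℂ) * wigner ħ u v z
      = -(Complex.I * ħ) * (Complex.I / ħ * (z.2 j : ℂ) * wigner ħ u v z) := by
    field_simp
    linear_combination (z.2 j : ℂ) * wigner ħ u v z * Complex.I_sq
  rw [h2, ← h1]
  ring

theorem coe_action (z : Space n × Space n) (j : Fin n) :
    (action z j : ℝ) = ((z.1 j) ^ 2 + (z.2 j) ^ 2) / 2 := rfl

/-- Multiplication by the classical oscillator `p_j` in terms of the ladder operators. The right
side maps pairs of Hermite states to combinations of pairs of Hermite states. -/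
theorem action_mul_wigner {ħ : ℝ} (hħ : 0 < ħ) (j : Fin n) (u v : 𝓢(Space n, ℂ))
    (z : Space n × Space n) : ((action z j : ℝ) : ℂ) * wigner ħ u v z
      = (wigner ħ (oscillator ħ j u) v z + wigner ħ u (oscillator ħ j v) z) / 4
        + (wigner ħ (lowering ħ j u) (lowering ħ j v) z
          + wigner ħ (raising ħ j u) (raising ħ j v) z) / 8 := by
  have hosc : ∀ w : 𝓢(Space n, ℂ), oscillator ħ j w
      = (1 / 2 : ℂ) • (position j (position j w) - ((ħ : ℂ) ^ 2) • partialDeriv j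
        (partialDeriv j w)) := by
    intro w
    have h1 := two_smul_oscillator ħ j w
    have h2 := congrArg (fun T => T w) (partialDeriv_position j j)
    simp only [if_true, mul_apply_eq_comp, add_apply, one_apply_eq_self] at h2
    simp only [raising, lowering, add_apply, sub_apply, smul_apply, map_add, map_smul, h2] at h1
    have h3 : oscillator ħ j w = (1 / 2 : ℂ) • ((2 : ℂ) • oscillator ħ j w) := by module
    rw [h3, h1]
    module
  have hx : ((z.1 j : ℝ) : ℂ) ^ 2 * wigner ħ u v z
      = (wigner ħ (position j (position j u)) v z + 2 * wigner ħ (position j u) (position j v) z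
        + wigner ħ u (position j (position j v)) z) / 4 := by
    rw [sq, mul_assoc, coord_mul_wigner, mul_div_assoc', mul_add, coord_mul_wigner,
      coord_mul_wigner]
    ring
  have hξ : ((z.2 j : ℝ) : ℂ) ^ 2 * wigner ħ u v z
      = -(ħ : ℂ) ^ 2 / 4 * (wigner ħ (partialDeriv j (partialDeriv j u)) v z
        - 2 * wigner ħ (partialDeriv j u) (partialDeriv j v) z
        + wigner ħ u (partialDeriv j (partialDeriv j v)) z) := by
    rw [sq, mul_assoc, momentum_mul_wigner hħ, mul_left_comm, mul_sub, momentum_mul_wigner hħ,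
      momentum_mul_wigner hħ]
    linear_combination ((ħ : ℂ) ^ 2 / 4 * (wigner ħ (partialDeriv j (partialDeriv j u)) v z
        - 2 * wigner ħ (partialDeriv j u) (partialDeriv j v) z
        + wigner ħ u (partialDeriv j (partialDeriv j v)) z)) * Complex.I_sq
  have hp : ((action z j : ℝ) : ℂ) = (((z.1 j : ℝ) : ℂ) ^ 2 + ((z.2 j : ℝ) : ℂ) ^ 2) / 2 := by
    rw [coe_action]
    push_cast
    ring
  rw [hp, div_mul_eq_mul_div, add_mul, hx, hξ]
  simp only [hosc, raising, lowering, wigner_smul_left, wigner_smul_right, wigner_sub_left,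
    wigner_sub_right, wigner_add_left, wigner_add_right, add_apply, sub_apply, smul_apply, map_pow,
    Complex.conj_ofReal, map_div₀, map_one, map_ofNat]
  ring

/-! ### Size and continuity of Wigner functions -/

theorem integral_comp_affine {F : Type*} [NormedAddCommGroup F] [NormedSpace ℝ F]
    (c : ℝ) (x : Space n) (g : Space n → F) :
    ∫ y, g (x + c • y) = |(c ^ n)⁻¹| • ∫ y, g y := by
  rw [Measure.integral_comp_smul volume (fun y => g (x + y)) c, finrank_euclideanSpace_fin,
    integral_add_left_eq_self]

theorem integrable_comp_affine {F : Type*} [NormedAddCommGroup F]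
    {c : ℝ} (hc : c ≠ 0) (x : Space n) {g : Space n → F} (hg : Integrable g) :
    Integrable fun y => g (x + c • y) :=
  (hg.comp_add_left x).comp_smul hc

theorem integral_norm_sq (u : 𝓢(Space n, ℂ)) : ∫ x, ‖u x‖ ^ 2 = ‖u.toLp 2 volume‖ ^ 2 := by
  have h := ip_eq_integral u u
  rw [ip, inner_self_eq_norm_sq_to_K] at h
  have h2 : ∀ x, conj (u x) * u x = ((‖u x‖ ^ 2 : ℝ) : ℂ) := fun x => by
    rw [Complex.conj_mul']; norm_cast
  simp only [h2, integral_complex_ofReal] at h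
  apply Complex.ofReal_injective
  rw [← h]
  norm_cast

theorem integrable_norm_sq (u : 𝓢(Space n, ℂ)) : Integrable fun x => ‖u x‖ ^ 2 :=
  (memLp_two_iff_integrable_sq_norm u.continuous.aestronglyMeasurable).mp (u.memLp 2 volume)

/-- A uniform bound for Wigner functions, from `|u v| ≤ (|u|² + |v|²) / 2`. It is used for
normalized `u = v`, where it says that `(2πħ)ⁿ W(u, u)` is bounded by `2ⁿ`. -/
theorem norm_wigner_le {ħ : ℝ} (hħ : 0 < ħ) (u v : 𝓢(Space n, ℂ)) (z : Space n × Space n) :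
    ‖wigner ħ u v z‖ ≤ (2 * Real.pi * ħ)⁻¹ ^ n * (2 ^ n *
      ((‖u.toLp 2 volume‖ ^ 2 + ‖v.toLp 2 volume‖ ^ 2) / 2)) := by
  have h2 : ∀ (c : ℝ), |c| = 1 / 2 → ∀ w : 𝓢(Space n, ℂ),
      ∫ y, ‖w (z.1 + c • y)‖ ^ 2 = 2 ^ n * ‖w.toLp 2 volume‖ ^ 2 := by
    intro c hc w
    rw [integral_comp_affine c z.1 (fun y => ‖w y‖ ^ 2), integral_norm_sq, abs_inv, abs_pow, hc,
      smul_eq_mul]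
    simp
  have hi : ∀ (c : ℝ), c ≠ 0 → ∀ w : 𝓢(Space n, ℂ),
      Integrable fun y => ‖w (z.1 + c • y)‖ ^ 2 := fun c hc w =>
    integrable_comp_affine hc z.1 (integrable_norm_sq w)
  rw [wigner, norm_mul, norm_pow, norm_inv, Complex.norm_real, Real.norm_of_nonneg (by positivity)]
  gcongr
  calc _ ≤ ∫ y, (‖u (z.1 + (1 / 2 : ℝ) • y)‖ ^ 2 + ‖v (z.1 + (-(1 / 2) : ℝ) • y)‖ ^ 2) / 2 := by
        refine norm_integral_le_of_norm_le
          (((hi _ (by norm_num) u).add (hi _ (by norm_num) v)).div_const 2)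
          (Filter.Eventually.of_forall fun y => ?_)
        have h3 : ‖Complex.exp (-(Complex.I * ((inner ℝ y z.2 / ħ : ℝ) : ℂ)))‖ = 1 := by
          rw [Complex.norm_exp]
          simp
        rw [norm_mul, norm_mul, h3, one_mul, RCLike.norm_conj, neg_smul, ← sub_eq_add_neg]
        nlinarith [sq_nonneg (‖u (z.1 + (1 / 2 : ℝ) • y)‖ - ‖v (z.1 - (1 / 2 : ℝ) • y)‖)]
    _ = _ := by
        rw [integral_div, integral_add (hi _ (by norm_num) u) (hi _ (by norm_num) v),
          h2 _ (by norm_num), h2 _ (by norm_num)]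
        ring

theorem continuous_wigner (ħ : ℝ) (u v : 𝓢(Space n, ℂ)) : Continuous (wigner ħ u v) := by
  -- After the substitution `w = x + y/2` the integrand is dominated uniformly in `(x, ξ)`.
  have h : wigner ħ u v = fun z => ((2 * Real.pi * ħ : ℝ) : ℂ)⁻¹ ^ n * ((2 ^ n : ℝ) •
      ∫ w, Complex.exp (-(Complex.I * ((inner ℝ ((2 : ℝ) • (w - z.1)) z.2 / ħ : ℝ) : ℂ)))
        * u w * conj (v ((2 : ℝ) • z.1 - w))) := by
    ext z
    rw [wigner]
    congr 1
    have h1 := integral_comp_affine (1 / 2) z.1 fun w =>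
      Complex.exp (-(Complex.I * ((inner ℝ ((2 : ℝ) • (w - z.1)) z.2 / ħ : ℝ) : ℂ)))
        * u w * conj (v ((2 : ℝ) • z.1 - w))
    have h2 : |(((1 : ℝ) / 2) ^ n)⁻¹| = 2 ^ n := by
      rw [abs_of_pos (by positivity)]
      simp
    rw [h2] at h1
    rw [← h1]
    congr 1
    ext y
    have e1 : (2 : ℝ) • (z.1 + (1 / 2 : ℝ) • y - z.1) = y := by module
    have e2 : (2 : ℝ) • z.1 - (z.1 + (1 / 2 : ℝ) • y) = z.1 - (1 / 2 : ℝ) • y := by module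
    rw [e1, e2]
  rw [h]
  refine continuous_const.mul ((continuous_const_smul ((2 : ℝ) ^ n)).comp ?_)
  refine continuous_of_dominated (bound := fun w => ‖u w‖ * SchwartzMap.seminorm ℝ 0 0 v)
    (fun z => Continuous.aestronglyMeasurable ?_)
    (fun z => Filter.Eventually.of_forall fun w => ?_) (u.integrable.norm.mul_const _)
    (Filter.Eventually.of_forall fun w => ?_)
  · have := u.continuous
    have := v.continuous
    fun_prop
  · rw [norm_mul, norm_mul, Complex.norm_exp]
    simp
    gcongr
    exact SchwartzMap.norm_le_seminorm ℝ v _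
  · have := u.continuous
    have := v.continuous
    fun_prop

theorem norm_sq_le_sum_action (z : Space n × Space n) :
    ‖z‖ ^ 2 ≤ 2 * ∑ j, (action z j : ℝ) := by
  have h : 2 * ∑ j, (action z j : ℝ) = ‖z.1‖ ^ 2 + ‖z.2‖ ^ 2 := by
    rw [EuclideanSpace.real_norm_sq_eq, EuclideanSpace.real_norm_sq_eq, ← Finset.sum_add_distrib,
      Finset.mul_sum]
    refine Finset.sum_congr rfl fun j _ => ?_
    rw [coe_action]
    ring
  rw [h, Prod.norm_def]
  rcases max_choice ‖z.1‖ ‖z.2‖ with h | h <;> rw [h] <;>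
    nlinarith [sq_nonneg ‖z.1‖, sq_nonneg ‖z.2‖]

/-- Wigner functions of Schwartz functions decay rapidly: multiplication by the classical
oscillators turns them into combinations of other such Wigner functions, which are bounded. -/
theorem exists_pow_mul_norm_wigner_le {ħ : ℝ} (hħ : 0 < ħ) (N : ℕ) (u v : 𝓢(Space n, ℂ)) :
    ∃ C, ∀ z, (1 + ‖z‖) ^ N * ‖wigner ħ u v z‖ ≤ C := by
  have key : ∀ (N : ℕ) (u v : 𝓢(Space n, ℂ)), ∃ C, ∀ z : Space n × Space n,
      (1 + 2 * ∑ j, (action z j : ℝ)) ^ N * ‖wigner ħ u v z‖ ≤ C := by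
    intro N
    induction N with
    | zero => exact fun u v => ⟨_, fun z => by simpa using norm_wigner_le hħ u v z⟩
    | succ N ih =>
      intro u v
      choose C hC using ih
      refine ⟨C u v + 2 * ∑ j, ((C (oscillator ħ j u) v + C u (oscillator ħ j v)) / 4
        + (C (lowering ħ j u) (lowering ħ j v) + C (raising ħ j u) (raising ħ j v)) / 8),
        fun z => ?_⟩
      set q := 1 + 2 * ∑ j, (action z j : ℝ) with hq
      have hq0 : 0 ≤ q := by positivity
      have h1 : ∀ j, q ^ N * ((action z j : ℝ) * ‖wigner ħ u v z‖)
          ≤ (C (oscillator ħ j u) v + C u (oscillator ħ j v)) / 4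
            + (C (lowering ħ j u) (lowering ħ j v) + C (raising ħ j u) (raising ħ j v)) / 8 := by
        intro j
        have e1 : (action z j : ℝ) * ‖wigner ħ u v z‖
            = ‖((action z j : ℝ) : ℂ) * wigner ħ u v z‖ := by
          rw [norm_mul, Complex.norm_real, Real.norm_of_nonneg (NNReal.coe_nonneg _)]
        have e2 : ‖((action z j : ℝ) : ℂ) * wigner ħ u v z‖
            ≤ (‖wigner ħ (oscillator ħ j u) v z‖ + ‖wigner ħ u (oscillator ħ j v) z‖) / 4
              + (‖wigner ħ (lowering ħ j u) (lowering ħ j v) z‖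
                + ‖wigner ħ (raising ħ j u) (raising ħ j v) z‖) / 8 := by
          rw [action_mul_wigner hħ]
          refine (norm_add_le _ _).trans (add_le_add ?_ ?_)
          · rw [norm_div, Complex.norm_ofNat]
            gcongr
            exact norm_add_le _ _
          · rw [norm_div, Complex.norm_ofNat]
            gcongr
            exact norm_add_le _ _
        rw [e1]
        refine (mul_le_mul_of_nonneg_left e2 (by positivity)).trans ?_
        have a1 := hC (oscillator ħ j u) v z
        have a2 := hC u (oscillator ħ j v) z
        have a3 := hC (lowering ħ j u) (lowering ħ j v) z
        have a4 := hC (raising ħ j u) (raising ħ j v) z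
        rw [← hq] at a1 a2 a3 a4
        linarith
      have h2 : q ^ (N + 1) * ‖wigner ħ u v z‖ = q ^ N * ‖wigner ħ u v z‖
          + 2 * ∑ j, q ^ N * ((action z j : ℝ) * ‖wigner ħ u v z‖) := by
        rw [← Finset.mul_sum, ← Finset.sum_mul, pow_succ]
        nth_rewrite 2 [hq]
        ring
      rw [h2]
      exact add_le_add (hC u v z) (mul_le_mul_of_nonneg_left
        (Finset.sum_le_sum fun j _ => h1 j) (by norm_num))
  obtain ⟨C, hC⟩ := key N u v
  refine ⟨2 ^ N * C, fun z => ?_⟩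
  have h1 := norm_sq_le_sum_action z
  have h2 : 1 + ‖z‖ ≤ 2 * (1 + 2 * ∑ j, (action z j : ℝ)) := by
    nlinarith [sq_nonneg (‖z‖ - 1)]
  calc _ ≤ (2 * (1 + 2 * ∑ j, (action z j : ℝ))) ^ N * ‖wigner ħ u v z‖ := by gcongr
    _ = 2 ^ N * ((1 + 2 * ∑ j, (action z j : ℝ)) ^ N * ‖wigner ħ u v z‖) := by
        rw [mul_pow, mul_assoc]
    _ ≤ _ := by gcongr; exact hC z

/-- A function on phase space is an admissible symbol if it is continuous and of at most
polynomial growth. -/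
def IsAdmissible (a : Space n × Space n → ℂ) : Prop :=
  Continuous a ∧ ∃ (C : ℝ) (N : ℕ), ∀ z, ‖a z‖ ≤ C * (1 + ‖z‖) ^ N

theorem IsAdmissible.integrable_mul_wigner {a : Space n × Space n → ℂ} (ha : IsAdmissible a)
    {ħ : ℝ} (hħ : 0 < ħ) (u v : 𝓢(Space n, ℂ)) : Integrable fun z => a z * wigner ħ u v z := by
  obtain ⟨hc, C, N, hC⟩ := ha
  set d := Module.finrank ℝ (Space n × Space n) + 1 with hd
  obtain ⟨C', hC'⟩ := exists_pow_mul_norm_wigner_le hħ (N + d) u v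
  have : (volume : Measure (Space n × Space n)).IsAddHaarMeasure := by
    rw [Measure.volume_eq_prod]
    infer_instance
  have hint : Integrable (fun z : Space n × Space n => (1 + ‖z‖) ^ (-(d : ℝ))) :=
    integrable_one_add_norm (by rw [hd]; push_cast; linarith)
  refine (hint.const_mul (|C| * C')).mono
    ((hc.mul (continuous_wigner ħ u v)).aestronglyMeasurable)
    (Filter.Eventually.of_forall fun z => ?_)
  have hz : 0 < 1 + ‖z‖ := by positivity
  rw [norm_mul, Real.norm_eq_abs]
  refine le_trans ?_ (le_abs_self _)
  rw [Real.rpow_neg hz.le, Real.rpow_natCast]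
  calc ‖a z‖ * ‖wigner ħ u v z‖
      ≤ (|C| * (1 + ‖z‖) ^ N) * ‖wigner ħ u v z‖ := by
        gcongr
        exact (hC z).trans (by gcongr; exact le_abs_self C)
    _ = |C| * ((1 + ‖z‖) ^ (N + d) * ‖wigner ħ u v z‖) * ((1 + ‖z‖) ^ d)⁻¹ := by
        rw [pow_add]
        field_simp
    _ ≤ |C| * C' * ((1 + ‖z‖) ^ d)⁻¹ := by
        gcongr
        exact hC' z

theorem isAdmissible_const (c : ℂ) : IsAdmissible fun _ : Space n × Space n => c :=
  ⟨continuous_const, ‖c‖, 0, fun z => by simp⟩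

theorem isAdmissible_wigner {ħ : ℝ} (hħ : 0 < ħ) (u v : 𝓢(Space n, ℂ)) :
    IsAdmissible (wigner ħ u v) := by
  obtain ⟨C, hC⟩ := exists_pow_mul_norm_wigner_le hħ 0 u v
  exact ⟨continuous_wigner ħ u v, C, 0, fun z => by simpa using hC z⟩

/-! ### Integrals of Wigner functions -/

theorem integral_fourier (s : 𝓢(Space n, ℂ)) :
    ∫ w, (FourierTransform.fourier s : 𝓢(Space n, ℂ)) w = s 0 := by
  have h := congrArg (fun f : 𝓢(Space n, ℂ) => f 0)
    (FourierTransform.fourierInv_fourier_eq (F := 𝓢(Space n, ℂ)) s)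
  rw [← h]
  simp only [SchwartzMap.fourierInv_coe, Real.fourierInv_eq']
  simp

theorem fourier_fourier (s : 𝓢(Space n, ℂ)) (y : Space n) :
    (FourierTransform.fourier (FourierTransform.fourier s : 𝓢(Space n, ℂ)) : 𝓢(Space n, ℂ)) y
      = s (-y) := by
  have h := congrArg (fun f : 𝓢(Space n, ℂ) => f (-y))
    (FourierTransform.fourierInv_fourier_eq (F := 𝓢(Space n, ℂ)) s)
  rw [← h]
  simp only [SchwartzMap.fourierInv_coe, Real.fourierInv_eq_fourier_neg, neg_neg]
  rfl

/-- The substitution `w = ξ / (2πħ)` absorbs the normalization of the Wigner function. -/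
theorem integral_momentum_scaling {ħ : ℝ} (hħ : 0 < ħ) (g : Space n → ℂ) :
    ((2 * Real.pi * ħ : ℝ) : ℂ)⁻¹ ^ n * ∫ ξ : Space n, g ((2 * Real.pi * ħ)⁻¹ • ξ)
      = ∫ w, g w := by
  have hpos : 0 < 2 * Real.pi * ħ := by positivity
  have hne : ((2 * Real.pi * ħ : ℝ) : ℂ) ≠ 0 := by exact_mod_cast hpos.ne'
  rw [Measure.integral_comp_smul volume g, finrank_euclideanSpace_fin, abs_of_pos (by positivity),
    Complex.real_smul, ← mul_assoc]
  push_cast at hne ⊢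
  rw [inv_pow, inv_inv, inv_mul_cancel₀ (pow_ne_zero n hne), one_mul]

/-- The constant function `1` is the Weyl symbol of the identity. -/
theorem integral_wigner {ħ : ℝ} (hħ : 0 < ħ) (u v : 𝓢(Space n, ℂ)) :
    ∫ z, wigner ħ u v z = ip v u := by
  have hint : Integrable (wigner ħ u v) := by
    simpa using (isAdmissible_const 1).integrable_mul_wigner hħ u v
  rw [Measure.volume_eq_prod] at hint ⊢
  rw [integral_prod _ hint, ip_eq_integral]
  congr 1 with x
  simp only [wigner_eq_fourier, integral_const_mul]
  rw [integral_momentum_scaling hħ, integral_fourier, wignerSlice_apply]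
  simp [mul_comm]

/-- The map `(x, y) ↦ (x + y / 2, x - y / 2)` preserves the volume. -/
theorem integral_integral_add_sub {A B : Space n → ℂ} (hA : Continuous A) (hB : Continuous B)
    (hA' : Integrable A) (hB' : Integrable B) :
    ∫ x, ∫ y, A (x + (1 / 2 : ℝ) • y) * B (x - (1 / 2 : ℝ) • y) = (∫ x, A x) * ∫ x, B x := by
  have h2 : |(((1 : ℝ) / 2) ^ n)⁻¹| = 2 ^ n := by
    rw [abs_of_pos (by positivity)]
    simp
  have h2' : |((2 : ℝ) ^ n)⁻¹| = (2 ^ n)⁻¹ := abs_of_pos (by positivity)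
  have h1 : ∀ x, ∫ y, A (x + (1 / 2 : ℝ) • y) * B (x - (1 / 2 : ℝ) • y)
      = (2 ^ n : ℝ) • ∫ w, A w * B (-w + (2 : ℝ) • x) := by
    intro x
    have h3 := integral_comp_affine (1 / 2) x fun w => A w * B (-w + (2 : ℝ) • x)
    rw [h2] at h3
    rw [← h3]
    congr 1 with y
    congr 2
    module
  have hB2 : ∀ w, Integrable fun x => B (-w + (2 : ℝ) • x) := fun w =>
    integrable_comp_affine two_ne_zero (-w) hB'
  have hint : Integrable (Function.uncurry fun (x w : Space n) => A w * B (-w + (2 : ℝ) • x))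
      (volume.prod volume) := by
    have hc : Continuous (Function.uncurry fun (x w : Space n) => A w * B (-w + (2 : ℝ) • x)) := by
      fun_prop
    rw [integrable_prod_iff' hc.aestronglyMeasurable]
    refine ⟨Filter.Eventually.of_forall fun w => (hB2 w).const_mul (A w), ?_⟩
    have h3 : ∀ w, ∫ x, ‖Function.uncurry (fun (x w : Space n) => A w * B (-w + (2 : ℝ) • x))
        (x, w)‖ = ‖A w‖ * ((2 ^ n)⁻¹ * ∫ x, ‖B x‖) := by
      intro w
      simp only [Function.uncurry, norm_mul, integral_const_mul]
      rw [integral_comp_affine 2 (-w) fun x => ‖B x‖, h2', smul_eq_mul]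
    simp only [h3]
    exact hA'.norm.mul_const _
  simp only [h1]
  rw [integral_smul, integral_integral_swap hint]
  simp only [integral_const_mul]
  have h4 : ∀ w, ∫ x, B (-w + (2 : ℝ) • x) = ((2 ^ n)⁻¹ : ℝ) • ∫ x, B x := fun w => by
    rw [integral_comp_affine 2 (-w) B, h2']
  simp only [h4]
  rw [integral_mul_const, Complex.real_smul, Complex.real_smul]
  push_cast
  have h5 : (2 : ℂ) ^ n ≠ 0 := pow_ne_zero _ two_ne_zero
  rw [mul_left_comm, mul_inv_cancel_left₀ h5]

/-- Moyal's identity: `(2πħ)ⁿ W(f, g)` is the Weyl symbol of the operator `u ↦ ⟨g, u⟩ f`. It is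
Parseval's formula in the momentum for fixed position, followed by the substitution
`integral_integral_add_sub`. -/
theorem integral_wigner_mul_wigner {ħ : ℝ} (hħ : 0 < ħ) (f g u v : 𝓢(Space n, ℂ)) :
    ∫ z, ((2 * Real.pi * ħ : ℝ) : ℂ) ^ n * wigner ħ f g z * wigner ħ u v z
      = ip v f * ip g u := by
  have hpos : 0 < 2 * Real.pi * ħ := by positivity
  have hne : ((2 * Real.pi * ħ : ℝ) : ℂ) ≠ 0 := by exact_mod_cast hpos.ne'
  have hint := (isAdmissible_wigner hħ f g).integrable_mul_wigner hħ u v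
  set c : ℂ := ((2 * Real.pi * ħ : ℝ) : ℂ)
  simp only [mul_assoc (c ^ n), integral_const_mul]
  rw [Measure.volume_eq_prod] at hint ⊢
  rw [integral_prod _ hint]
  have h1 : ∀ x, ∫ ξ, wigner ħ f g (x, ξ) * wigner ħ u v (x, ξ)
      = ((2 * Real.pi * ħ : ℝ) : ℂ)⁻¹ ^ n * ∫ y,
        (f (x + (1 / 2 : ℝ) • y) * conj (v (x + (1 / 2 : ℝ) • y)))
          * (u (x - (1 / 2 : ℝ) • y) * conj (g (x - (1 / 2 : ℝ) • y))) := by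
    intro x
    have h2 : ∀ ξ, wigner ħ f g (x, ξ) * wigner ħ u v (x, ξ)
        = ((2 * Real.pi * ħ : ℝ) : ℂ)⁻¹ ^ n * (((2 * Real.pi * ħ : ℝ) : ℂ)⁻¹ ^ n *
          (fun w => FourierTransform.fourier (wignerSlice f g x) w
            * FourierTransform.fourier (wignerSlice u v x) w) ((2 * Real.pi * ħ)⁻¹ • ξ)) := by
      intro ξ
      rw [wigner_eq_fourier, wigner_eq_fourier]
      ring
    simp only [h2, integral_const_mul]
    rw [integral_momentum_scaling hħ (fun w => FourierTransform.fourier (wignerSlice f g x) w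
            * FourierTransform.fourier (wignerSlice u v x) w), SchwartzMap.integral_fourier_mul_eq]
    congr 2 with y
    rw [fourier_fourier, wignerSlice_apply, wignerSlice_apply, smul_neg, ← sub_eq_add_neg,
      sub_neg_eq_add]
    ring
  simp only [h1, integral_const_mul]
  have hi : ∀ p q : 𝓢(Space n, ℂ), Integrable fun x => p x * conj (q x) := fun p q =>
    ((integrable_norm_sq p).add (integrable_norm_sq q)).mono
      (p.continuous.mul (Complex.continuous_conj.comp q.continuous)).aestronglyMeasurable
      (Filter.Eventually.of_forall fun x => by
        rw [norm_mul, RCLike.norm_conj, Pi.add_apply, Real.norm_of_nonneg (by positivity)]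
        nlinarith [sq_nonneg (‖p x‖ - ‖q x‖), sq_nonneg ‖p x‖, sq_nonneg ‖q x‖])
  rw [integral_integral_add_sub (A := fun x => f x * conj (v x)) (B := fun x => u x * conj (g x))
    (f.continuous.mul (Complex.continuous_conj.comp v.continuous))
    (u.continuous.mul (Complex.continuous_conj.comp g.continuous)) (hi f v) (hi u g),
    ← mul_assoc, ← mul_pow, mul_inv_cancel₀ hne, one_pow, one_mul, ip_eq_integral, ip_eq_integral]
  simp only [mul_comm]

/-! ### Weyl symbols are unique -/

theorem hasTemperateGrowth_exp_mul_I :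
    (fun t : ℝ => Complex.exp (t * Complex.I)).HasTemperateGrowth := by
  have hd : ∀ m : ℕ, iteratedDeriv m (fun t : ℝ => Complex.exp (t * Complex.I))
      = fun t : ℝ => Complex.I ^ m * Complex.exp (t * Complex.I) := by
    intro m
    induction m with
    | zero => simp
    | succ m ih =>
      rw [iteratedDeriv_succ, ih]
      ext t
      have h1 : HasDerivAt (fun t : ℝ => Complex.exp (t * Complex.I))
          (Complex.exp (t * Complex.I) * Complex.I) t := by
        simpa using (Complex.ofRealCLM.hasDerivAt.mul_const Complex.I).cexp
      rw [(h1.const_mul _).deriv]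
      ring
  refine ⟨(Complex.ofRealCLM.contDiff.mul contDiff_const).cexp, fun m => ⟨0, 1, fun t => ?_⟩⟩
  rw [norm_iteratedFDeriv_eq_norm_iteratedDeriv, hd, norm_mul, norm_pow, Complex.norm_I,
    Complex.norm_exp_ofReal_mul_I]
  simp

/-- Multiplying a Wigner function by a character of phase space gives another Wigner function: the
functions `u` and `v` are translated by opposite vectors and modulated by opposite phases. -/
theorem exists_wigner_eq_character_mul {ħ : ℝ} (hħ : 0 < ħ) (u v : 𝓢(Space n, ℂ))
    (β α : Space n) : ∃ u' v' : 𝓢(Space n, ℂ), ∀ z, wigner ħ u' v' z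
      = Complex.exp (((inner ℝ z.1 β + inner ℝ z.2 α : ℝ) : ℂ) * Complex.I) * wigner ħ u v z := by
  -- Translating `u` by `-τ` and `v` by `τ` shifts `y` by `2τ = ħ α`, and modulating by `± β / 2`
  -- produces the phase `⟪x, β⟫`, since `x` is the mean of the arguments of `u` and `v`.
  set τ : Space n := (ħ / 2) • α with hτ
  have hg : ∀ γ : Space n,
      (fun x : Space n => Complex.exp (((inner ℝ x γ : ℝ) : ℂ) * Complex.I)).HasTemperateGrowth :=
    fun γ => hasTemperateGrowth_exp_mul_I.comp
      (Function.hasTemperateGrowth_inner_left (H := Space n) γ)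
  set M : Space n → 𝓢(Space n, ℂ) → 𝓢(Space n, ℂ) := fun γ w =>
    SchwartzMap.smulLeftCLM ℂ
      (fun x : Space n => Complex.exp (((inner ℝ x γ : ℝ) : ℂ) * Complex.I)) w with hM
  have hMa : ∀ γ w x, M γ w x = Complex.exp (((inner ℝ x γ : ℝ) : ℂ) * Complex.I) * w x := by
    intro γ w x
    rw [hM]
    simp only [SchwartzMap.smulLeftCLM_apply_apply (hg γ), smul_eq_mul]
  refine ⟨M ((1 / 2 : ℝ) • β) (SchwartzMap.compSubConstCLM ℂ (-τ) u),
    M (-((1 / 2 : ℝ) • β)) (SchwartzMap.compSubConstCLM ℂ τ v), fun z => ?_⟩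
  set F : Space n → ℂ := fun y =>
    Complex.exp (-(Complex.I * ((inner ℝ (y - (2 : ℝ) • τ) z.2 / ħ : ℝ) : ℂ)))
      * u (z.1 + (1 / 2 : ℝ) • y) * conj (v (z.1 - (1 / 2 : ℝ) • y)) with hF
  have e1 : ∀ y, Complex.exp (-(Complex.I * ((inner ℝ y z.2 / ħ : ℝ) : ℂ)))
      * M ((1 / 2 : ℝ) • β) (SchwartzMap.compSubConstCLM ℂ (-τ) u) (z.1 + (1 / 2 : ℝ) • y)
      * conj (M (-((1 / 2 : ℝ) • β)) (SchwartzMap.compSubConstCLM ℂ τ v) (z.1 - (1 / 2 : ℝ) • y))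
      = Complex.exp (((inner ℝ z.1 β : ℝ) : ℂ) * Complex.I) * F (y + (2 : ℝ) • τ) := by
    intro y
    have a1 : z.1 + (1 / 2 : ℝ) • y - -τ = z.1 + (1 / 2 : ℝ) • (y + (2 : ℝ) • τ) := by module
    have a2 : z.1 - (1 / 2 : ℝ) • y - τ = z.1 - (1 / 2 : ℝ) • (y + (2 : ℝ) • τ) := by module
    rw [hMa, hMa, SchwartzMap.compSubConstCLM_apply, SchwartzMap.compSubConstCLM_apply, a1, a2, hF]
    simp only [add_sub_cancel_right, map_mul, ← Complex.exp_conj, Complex.conj_ofReal,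
      Complex.conj_I]
    have a3 : Complex.exp (((inner ℝ z.1 β : ℝ) : ℂ) * Complex.I)
        = Complex.exp (((inner ℝ (z.1 + (1 / 2 : ℝ) • y) ((1 / 2 : ℝ) • β) : ℝ) : ℂ) * Complex.I)
          * Complex.exp (((inner ℝ (z.1 - (1 / 2 : ℝ) • y) (-((1 / 2 : ℝ) • β)) : ℝ) : ℂ)
            * -Complex.I) := by
      rw [← Complex.exp_add]
      congr 1
      simp only [inner_add_left, inner_sub_left, inner_smul_left, inner_smul_right, inner_neg_right,
        RCLike.conj_to_real]
      push_cast
      ring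
    rw [a3]
    ring
  have e2 : ∀ y, F y = Complex.exp (((inner ℝ z.2 α : ℝ) : ℂ) * Complex.I) *
      (Complex.exp (-(Complex.I * ((inner ℝ y z.2 / ħ : ℝ) : ℂ)))
        * u (z.1 + (1 / 2 : ℝ) • y) * conj (v (z.1 - (1 / 2 : ℝ) • y))) := by
    intro y
    rw [hF]
    simp only [← mul_assoc, ← Complex.exp_add]
    congr 3
    have a1 : inner ℝ (y - (2 : ℝ) • τ) z.2 / ħ = inner ℝ y z.2 / ħ - inner ℝ z.2 α := by
      rw [inner_sub_left, hτ, smul_smul, inner_smul_left, RCLike.conj_to_real,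
        real_inner_comm z.2 α]
      field_simp
    rw [a1]
    push_cast
    ring
  rw [wigner, wigner]
  simp only [e1, integral_const_mul]
  rw [integral_add_right_eq_self F]
  simp only [e2, integral_const_mul]
  push_cast
  rw [add_mul, Complex.exp_add]
  ring

/-- The Wigner function of the ground state is a Gaussian in the classical oscillators. -/
theorem exists_wigner_gaussian_eq {ħ : ℝ} (hħ : 0 < ħ) : ∃ K : ℂ, K ≠ 0 ∧
    ∀ z : Space n × Space n, wigner ħ (gaussian n (1 / (2 * ħ)) (by positivity))
      (gaussian n (1 / (2 * ħ)) (by positivity)) z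
        = K * Complex.exp (-(2 / ħ * ∑ j, (action z j : ℝ) : ℝ)) := by
  have hpos : 0 < 2 * Real.pi * ħ := by positivity
  have hne : ((2 * Real.pi * ħ : ℝ) : ℂ) ≠ 0 := by exact_mod_cast hpos.ne'
  have hħ' : (ħ : ℂ) ≠ 0 := by exact_mod_cast hħ.ne'
  have hpi : (Real.pi : ℂ) ≠ 0 := by exact_mod_cast Real.pi_ne_zero
  have hb : 0 < 1 / (4 * ħ) := by positivity
  set b : ℂ := ((1 / (4 * ħ) : ℝ) : ℂ) with hbdef
  have hb0 : b ≠ 0 := Complex.ofReal_ne_zero.mpr hb.ne'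
  refine ⟨((2 * Real.pi * ħ : ℝ) : ℂ)⁻¹ ^ n * (Real.pi / b) ^ ((n : ℂ) / 2), ?_, fun z => ?_⟩
  · refine mul_ne_zero (pow_ne_zero _ (inv_ne_zero hne)) ?_
    rw [Complex.cpow_ne_zero_iff]
    exact Or.inl (div_ne_zero hpi hb0)
  have hs : wignerSlice (gaussian n (1 / (2 * ħ)) (by positivity))
      (gaussian n (1 / (2 * ħ)) (by positivity)) z.1
      = Complex.exp (-(1 / ħ * ‖z.1‖ ^ 2 : ℝ)) • gaussian n (1 / (4 * ħ)) hb := by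
    ext y
    rw [wignerSlice_apply, smul_apply, gaussian_apply, gaussian_apply, gaussian_apply,
      ← Complex.exp_conj, Complex.conj_ofReal, smul_eq_mul, ← Complex.exp_add, ← Complex.exp_add]
    congr 1
    norm_cast
    have h1 := parallelogram_law_with_norm ℝ z.1 ((1 / 2 : ℝ) • y)
    rw [norm_smul, Real.norm_of_nonneg (by norm_num : (0 : ℝ) ≤ 1 / 2)] at h1
    have h2 : ‖z.1 + (1 / 2 : ℝ) • y‖ ^ 2 + ‖z.1 - (1 / 2 : ℝ) • y‖ ^ 2
        = 2 * (‖z.1‖ ^ 2 + ‖y‖ ^ 2 / 4) := by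
      linear_combination h1
    have h3 : -(1 / (2 * ħ)) * ‖z.1 + (1 / 2 : ℝ) • y‖ ^ 2
        + -(1 / (2 * ħ)) * ‖z.1 - (1 / 2 : ℝ) • y‖ ^ 2
        = -(1 / (2 * ħ)) * (2 * (‖z.1‖ ^ 2 + ‖y‖ ^ 2 / 4)) := by rw [← h2]; ring
    rw [h3]
    field_simp
    ring
  have hf : FourierTransform.fourier (gaussian n (1 / (4 * ħ)) hb) ((2 * Real.pi * ħ)⁻¹ • z.2)
      = (Real.pi / b) ^ ((n : ℂ) / 2) * Complex.exp (-(1 / ħ * ‖z.2‖ ^ 2 : ℝ)) := by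
    have h1 := fourier_gaussian_innerProductSpace (b := b) (by simpa [hbdef] using hħ)
      ((2 * Real.pi * ħ)⁻¹ • z.2)
    rw [finrank_euclideanSpace_fin] at h1
    have h2 : (fun v : Space n => Complex.exp (-b * (‖v‖ : ℂ) ^ 2))
        = ⇑(gaussian n (1 / (4 * ħ)) hb) := by
      ext y
      rw [gaussian_apply, hbdef]
      push_cast
      rfl
    rw [h2] at h1
    rw [SchwartzMap.fourier_coe, h1]
    congr 2
    rw [norm_smul, norm_inv, Real.norm_of_nonneg hpos.le, hbdef]
    push_cast
    field_simp
    ring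
  rw [wigner_eq_sliceTransform, hs, map_smul, smul_eq_mul]
  simp only [sliceTransform, LinearMap.coe_mk, AddHom.coe_mk, hf]
  have hsum : 2 / ħ * ∑ j, (action z j : ℝ) = 1 / ħ * ‖z.1‖ ^ 2 + 1 / ħ * ‖z.2‖ ^ 2 := by
    rw [EuclideanSpace.real_norm_sq_eq, EuclideanSpace.real_norm_sq_eq, ← mul_add,
      ← Finset.sum_add_distrib, Finset.mul_sum, Finset.mul_sum]
    refine Finset.sum_congr rfl fun j _ => ?_
    rw [coe_action]
    ring
  rw [hsum]
  push_cast
  rw [neg_add, Complex.exp_add]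
  ring

/-- An admissible symbol which pairs to zero with all Wigner functions vanishes: multiplied by the
Wigner function of the ground state it is integrable, with vanishing Fourier transform. -/
theorem IsAdmissible.eq_zero_of_integral_eq_zero {ħ : ℝ} (hħ : 0 < ħ)
    {a : Space n × Space n → ℂ} (ha : IsAdmissible a)
    (h : ∀ u v, ∫ z, a z * wigner ħ u v z = 0) : a = 0 := by
  set u₀ := gaussian n (1 / (2 * ħ)) (by positivity) with hu₀
  -- The Fourier transform lives on an inner product space, so phase space is given the `ℓ²` norm
  -- in place of the sup norm of the product.
  obtain ⟨K, hK, hW⟩ := exists_wigner_gaussian_eq (n := n) hħ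
  rw [← hu₀] at hW
  have hpres := WithLp.volume_preserving_ofLp (Space n) (Space n)
  have hemb : MeasurableEmbedding (WithLp.ofLp : WithLp 2 (Space n × Space n) → _) :=
    (MeasurableEquiv.toLp 2 (Space n × Space n)).symm.measurableEmbedding
  set g : WithLp 2 (Space n × Space n) → ℂ := fun p => a p.ofLp * wigner ħ u₀ u₀ p.ofLp with hg
  have hgi : Integrable g :=
    (hpres.integrable_comp_emb hemb).mpr (ha.integrable_mul_wigner hħ u₀ u₀)
  have hgc : Continuous g := by
    have h1 := WithLp.prod_continuous_ofLp 2 (Space n) (Space n)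
    exact (ha.1.comp h1).mul ((continuous_wigner ħ u₀ u₀).comp h1)
  have hf : ∀ w, FourierTransform.fourier g w = 0 := by
    intro w
    obtain ⟨u', v', huv⟩ := exists_wigner_eq_character_mul hħ u₀ u₀
      ((-(2 * Real.pi)) • w.fst) ((-(2 * Real.pi)) • w.snd)
    rw [Real.fourier_eq', ← h u' v', ← hpres.integral_comp hemb]
    congr 1 with p
    rw [huv, hg, WithLp.prod_inner_apply]
    simp only [smul_eq_mul, inner_smul_right]
    rw [mul_left_comm]
    congr 3
    have e1 : w.ofLp.1 = w.fst := rfl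
    have e2 : w.ofLp.2 = w.snd := rfl
    have e3 : p.ofLp.1 = p.fst := rfl
    have e4 : p.ofLp.2 = p.snd := rfl
    simp only [e1, e2, e3, e4]
    push_cast
    ring
  have hz : g = fun _ => 0 :=
    (Continuous.ae_eq_iff_eq volume hgc continuous_const).mp (ae_eq_zero_of_fourier_eq_zero hgi hf)
  ext z
  have h1 := congrFun hz (WithLp.toLp 2 z)
  simp only [hg, hW] at h1
  exact (mul_eq_zero.mp h1).resolve_right (mul_ne_zero hK (Complex.exp_ne_zero _))

/-! ### Symbols of operators which are diagonal in the Hermite basis -/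

/-- The matrix element `⟨v, φ_k⟩ ⟨φ_k, u⟩` of the projection onto the Hermite function `φ_k`. -/
noncomputable def hermiteCoeff (hħ : 0 < ħ) (u v : 𝓢(Space n, ℂ)) (k : Fin n → ℕ) : ℂ :=
  ip v (hermite ħ hħ k) * ip (hermite ħ hħ k) u

theorem hasSum_hermiteCoeff (hħ : 0 < ħ) (u v : 𝓢(Space n, ℂ)) :
    HasSum (hermiteCoeff hħ u v) (ip v u) :=
  hasSum_of_eq ((hermiteBasis n ħ hħ).hasSum_inner_mul_inner (v.toLp 2) (u.toLp 2)) fun k => by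
    rw [hermiteBasis_apply]
    rfl

theorem hermiteCoeff_oscillator_left (hħ : 0 < ħ) (j : Fin n) (u v : 𝓢(Space n, ℂ))
    (k : Fin n → ℕ) :
    hermiteCoeff hħ (oscillator ħ j u) v k = (level ħ k j : ℝ) * hermiteCoeff hħ u v k := by
  rw [hermiteCoeff, hermiteCoeff, ← ip_oscillator, oscillator_hermite, ip_smul_left,
    Complex.conj_ofReal]
  ring

theorem hermiteCoeff_oscillator_right (hħ : 0 < ħ) (j : Fin n) (u v : 𝓢(Space n, ℂ))
    (k : Fin n → ℕ) :
    hermiteCoeff hħ u (oscillator ħ j v) k = (level ħ k j : ℝ) * hermiteCoeff hħ u v k := by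
  rw [hermiteCoeff, hermiteCoeff, ip_oscillator, oscillator_hermite, ip_smul_right]
  ring

/-- The square of the matrix elements of the normalized ladder operators. -/
theorem sq_ladder_factor (hħ : 0 < ħ) (m : ℕ) :
    ((√(2 * ħ * (m + 1)) : ℝ) : ℂ) * (√(2 * ħ * (m + 1)) : ℝ) = 2 * ħ * (m + 1) := by
  rw [← Complex.ofReal_mul, Real.mul_self_sqrt (by positivity)]
  push_cast
  rfl

theorem hermiteCoeff_lowering (hħ : 0 < ħ) (j : Fin n) (u v : 𝓢(Space n, ℂ)) (k : Fin n → ℕ) :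
    hermiteCoeff hħ (lowering ħ j u) (lowering ħ j v) k
      = 2 * ħ * (k j + 1) * hermiteCoeff hħ u v (k + Pi.single j 1) := by
  rw [hermiteCoeff, hermiteCoeff, ip_lowering, ← ip_raising, raising_hermite, ip_smul_left,
    ip_smul_right, Complex.conj_ofReal, ← sq_ladder_factor hħ]
  ring

theorem hermiteCoeff_raising_add (hħ : 0 < ħ) (j : Fin n) (u v : 𝓢(Space n, ℂ)) (k : Fin n → ℕ) :
    hermiteCoeff hħ (raising ħ j u) (raising ħ j v) (k + Pi.single j 1)
      = 2 * ħ * (k j + 1) * hermiteCoeff hħ u v k := by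
  rw [hermiteCoeff, hermiteCoeff, ip_raising, ← ip_lowering, lowering_hermite_add, ip_smul_left,
    ip_smul_right, Complex.conj_ofReal, ← sq_ladder_factor hħ]
  ring

theorem hermiteCoeff_raising_of_eq_zero (hħ : 0 < ħ) {j : Fin n} (u v : 𝓢(Space n, ℂ))
    {k : Fin n → ℕ} (hk : k j = 0) :
    hermiteCoeff hħ (raising ħ j u) (raising ħ j v) k = 0 := by
  rw [hermiteCoeff, ip_raising, lowering_hermite_of_eq_zero ħ hħ hk, ip_zero_right, zero_mul]

theorem IsAdmissible.add {a a' : Space n × Space n → ℂ} (h : IsAdmissible a)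
    (h' : IsAdmissible a') : IsAdmissible fun z => a z + a' z := by
  obtain ⟨hc, C, N, hC⟩ := h
  obtain ⟨hc', C', N', hC'⟩ := h'
  refine ⟨hc.add hc', |C| + |C'|, N + N', fun z => ?_⟩
  have h1 : (1 : ℝ) ≤ 1 + ‖z‖ := by linarith [norm_nonneg z]
  have h2 : (1 + ‖z‖) ^ N ≤ (1 + ‖z‖) ^ (N + N') := pow_le_pow_right₀ h1 (by omega)
  have h3 : (1 + ‖z‖) ^ N' ≤ (1 + ‖z‖) ^ (N + N') := pow_le_pow_right₀ h1 (by omega)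
  calc ‖a z + a' z‖ ≤ ‖a z‖ + ‖a' z‖ := norm_add_le _ _
    _ ≤ C * (1 + ‖z‖) ^ N + C' * (1 + ‖z‖) ^ N' := add_le_add (hC z) (hC' z)
    _ ≤ |C| * (1 + ‖z‖) ^ (N + N') + |C'| * (1 + ‖z‖) ^ (N + N') := by
      refine add_le_add ?_ ?_
      · exact mul_le_mul (le_abs_self C) h2 (by positivity) (abs_nonneg C)
      · exact mul_le_mul (le_abs_self C') h3 (by positivity) (abs_nonneg C')
    _ = (|C| + |C'|) * (1 + ‖z‖) ^ (N + N') := by ring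

theorem IsAdmissible.const_mul {a : Space n × Space n → ℂ} (h : IsAdmissible a) (r : ℂ) :
    IsAdmissible fun z => r * a z := by
  obtain ⟨hc, C, N, hC⟩ := h
  refine ⟨continuous_const.mul hc, ‖r‖ * C, N, fun z => ?_⟩
  rw [norm_mul, mul_assoc]
  exact mul_le_mul_of_nonneg_left (hC z) (norm_nonneg r)

/-- `a` is the Weyl symbol of the operator which multiplies the Hermite function `φ_k` by `c k`.
The `c k` may grow, so the operator is given by its matrix elements between Schwartz functions. -/
def HasDiagonalSymbol (hħ : 0 < ħ) (c : (Fin n → ℕ) → ℂ) (a : Space n × Space n → ℂ) : Prop :=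
  IsAdmissible a ∧ ∀ u v : 𝓢(Space n, ℂ),
    HasSum (fun k => c k * hermiteCoeff hħ u v k) (∫ z, a z * wigner ħ u v z)

theorem HasDiagonalSymbol.unique {hħ : 0 < ħ} {c : (Fin n → ℕ) → ℂ}
    {a a' : Space n × Space n → ℂ} (h : HasDiagonalSymbol hħ c a)
    (h' : HasDiagonalSymbol hħ c a') : a = a' := by
  have h0 := (h.1.add (h'.1.const_mul (-1))).eq_zero_of_integral_eq_zero hħ fun u v => by
    simp only [add_mul, mul_assoc]
    rw [integral_add (h.1.integrable_mul_wigner hħ u v)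
      ((h'.1.integrable_mul_wigner hħ u v).const_mul (-1)), integral_const_mul,
      (h.2 u v).unique (h'.2 u v)]
    ring
  ext z
  have h1 := congrFun h0 z
  simp only [Pi.zero_apply] at h1
  linear_combination h1

/-- The operator with eigenvalues `c k` on the Hermite functions has a Weyl symbol which is a
function of the classical oscillators. -/
def HasRadialSymbol (hħ : 0 < ħ) (c : (Fin n → ℕ) → ℂ) : Prop :=
  ∃ a, HasDiagonalSymbol hħ c a ∧ Function.FactorsThrough a action

theorem HasRadialSymbol.add {hħ : 0 < ħ} {c c' : (Fin n → ℕ) → ℂ} (h : HasRadialSymbol hħ c)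
    (h' : HasRadialSymbol hħ c') : HasRadialSymbol hħ (fun k => c k + c' k) := by
  obtain ⟨a, ⟨ha, hs⟩, hr⟩ := h
  obtain ⟨a', ⟨ha', hs'⟩, hr'⟩ := h'
  refine ⟨fun z => a z + a' z, ⟨ha.add ha', fun u v => ?_⟩,
    fun z w hzw => by simp only [hr hzw, hr' hzw]⟩
  simp only [add_mul]
  rw [integral_add (ha.integrable_mul_wigner hħ u v) (ha'.integrable_mul_wigner hħ u v)]
  exact (hs u v).add (hs' u v)

theorem HasRadialSymbol.const_mul {hħ : 0 < ħ} {c : (Fin n → ℕ) → ℂ} (h : HasRadialSymbol hħ c)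
    (r : ℂ) : HasRadialSymbol hħ (fun k => r * c k) := by
  obtain ⟨a, ⟨ha, hs⟩, hr⟩ := h
  refine ⟨fun z => r * a z, ⟨ha.const_mul r, fun u v => ?_⟩,
    fun z w hzw => by simp only [hr hzw]⟩
  simp only [mul_assoc, integral_const_mul]
  exact (hs u v).mul_left r

theorem hasRadialSymbol_one (hħ : 0 < ħ) : HasRadialSymbol (n := n) hħ fun _ => 1 := by
  refine ⟨fun _ => 1, ⟨isAdmissible_const 1, fun u v => ?_⟩, fun _ _ _ => rfl⟩
  simp only [one_mul, integral_wigner hħ]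
  exact hasSum_hermiteCoeff hħ u v

theorem hasSum_add_single_iff {f : (Fin n → ℕ) → ℂ} {s : ℂ} (j : Fin n)
    (hf : ∀ k, k j = 0 → f k = 0) :
    HasSum (fun k : Fin n → ℕ => f (k + Pi.single j 1 : Fin n → ℕ)) s ↔ HasSum f s := by
  refine Function.Injective.hasSum_iff (g := fun k : Fin n → ℕ => (k + Pi.single j 1 : Fin n → ℕ))
    (add_left_injective _) fun k hk => hf k ?_
  by_contra h
  exact hk ⟨_, sub_single_add_single h⟩

/-- The eigenvalues of the operator whose Weyl symbol is `p_j a`, where `a` is the symbol of the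
operator with eigenvalues `c`. The truncated `k - Pi.single j 1` for `k j = 0` is harmless, its
coefficient being zero. -/
noncomputable def actionShift (ħ : ℝ) (j : Fin n) (c : (Fin n → ℕ) → ℂ) (k : Fin n → ℕ) : ℂ :=
  (level ħ k j : ℝ) * c k / 2
    + ħ * (k j * c (k - Pi.single j 1) + (k j + 1) * c (k + Pi.single j 1)) / 4

/-- Multiplying the symbol by `p_j` applies `actionShift ħ j` to the eigenvalues. -/
theorem HasRadialSymbol.actionShift {hħ : 0 < ħ} {c : (Fin n → ℕ) → ℂ}
    (h : HasRadialSymbol hħ c) (j : Fin n) : HasRadialSymbol hħ (actionShift ħ j c) := by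
  obtain ⟨a, ⟨ha, hs⟩, hr⟩ := h
  have hi := fun u v => ha.integrable_mul_wigner hħ u v
  obtain ⟨hc, C, N, hC⟩ := ha
  refine ⟨fun z => (action z j : ℝ) * a z, ⟨⟨?_, C, N + 2, fun z => ?_⟩, fun u v => ?_⟩,
    fun z w hzw => by simp only [hr hzw, hzw]⟩
  · simp only [coe_action]
    fun_prop
  · have h1 : (action z j : ℝ) ≤ (1 + ‖z‖) ^ 2 := by
      rw [coe_action]
      have h2 : |z.1 j| ≤ ‖z‖ := (PiLp.norm_apply_le z.1 j).trans (norm_fst_le z)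
      have h3 : |z.2 j| ≤ ‖z‖ := (PiLp.norm_apply_le z.2 j).trans (norm_snd_le z)
      have h4 := sq_le_sq' (neg_le_of_abs_le h2) (le_of_abs_le h2)
      have h5 := sq_le_sq' (neg_le_of_abs_le h3) (le_of_abs_le h3)
      nlinarith [norm_nonneg z]
    rw [norm_mul, Complex.norm_real, Real.norm_of_nonneg (NNReal.coe_nonneg _), pow_add]
    calc (action z j : ℝ) * ‖a z‖ ≤ (1 + ‖z‖) ^ 2 * (C * (1 + ‖z‖) ^ N) :=
          mul_le_mul h1 (hC z) (norm_nonneg _) (by positivity)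
      _ = C * ((1 + ‖z‖) ^ N * (1 + ‖z‖) ^ 2) := by ring
  · have e1 : ∀ z, (action z j : ℝ) * a z * wigner ħ u v z
        = (a z * wigner ħ (oscillator ħ j u) v z + a z * wigner ħ u (oscillator ħ j v) z) / 4
          + (a z * wigner ħ (lowering ħ j u) (lowering ħ j v) z
            + a z * wigner ħ (raising ħ j u) (raising ħ j v) z) / 8 := by
      intro z
      linear_combination a z * action_mul_wigner hħ j u v z
    -- The four Wigner functions are paired with `a` separately, and the two sums involving ladder
    -- operators are reindexed by `k ↦ k ± e_j`.
    have e2 : ∀ {A B C D : Space n × Space n → ℂ}, Integrable A → Integrable B → Integrable C →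
        Integrable D → ∫ z, ((A z + B z) / 4 + (C z + D z) / 8)
          = ((∫ z, A z) + ∫ z, B z) / 4 + ((∫ z, C z) + ∫ z, D z) / 8 := by
      intro A B C D hA hB hC hD
      have hAB : Integrable fun z => (A z + B z) / 4 := (hA.add hB).div_const 4
      have hCD : Integrable fun z => (C z + D z) / 8 := (hC.add hD).div_const 8
      rw [integral_add hAB hCD, integral_div, integral_div, integral_add hA hB, integral_add hC hD]
    simp only [e1]
    rw [e2 (hi _ _) (hi _ _) (hi _ _) (hi _ _)]
    have s3 := (hasSum_add_single_iff (f := fun k => c (k - Pi.single j 1)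
        * (2 * ħ * k j * hermiteCoeff hħ u v k)) (s := _) j fun k hk => by simp [hk]).mp
      (hasSum_of_eq (hs (lowering ħ j u) (lowering ħ j v)) fun k => by
        rw [hermiteCoeff_lowering, add_tsub_cancel_right]
        simp)
    have s4 := (hasSum_add_single_iff j fun k hk => by
        rw [hermiteCoeff_raising_of_eq_zero hħ u v hk, mul_zero]).mpr
      (hs (raising ħ j u) (raising ħ j v))
    refine hasSum_of_eq ((((hs _ _).add (hs _ _)).div_const 4).add ((s3.add s4).div_const 8))
      fun k => ?_
    rw [hermiteCoeff_oscillator_left, hermiteCoeff_oscillator_right, hermiteCoeff_raising_add,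
      WeylOscillator.actionShift]
    ring

/-! ### Polynomials of the oscillators -/

/-- The one-variable polynomial `t_m` for which `t_m(P)` has the Weyl symbol `p ^ m`, defined by
`t_0 = 1` and `t_{m+1}(s) = s t_m(s) + (ħ² / 4) m² t_{m-1}(s)`. -/
noncomputable def ladderPoly (ħ : ℝ) : ℕ → ℂ → ℂ
  | 0, _ => 1
  | 1, s => s
  | m + 2, s => s * ladderPoly ħ (m + 1) s + ħ ^ 2 / 4 * (m + 1) ^ 2 * ladderPoly ħ m s

theorem ladderPoly_succ (ħ : ℝ) (m : ℕ) (s : ℂ) : ladderPoly ħ (m + 1) s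
    = s * ladderPoly ħ m s + ħ ^ 2 / 4 * m ^ 2 * ladderPoly ħ (m - 1) s := by
  cases m with
  | zero => simp [ladderPoly]
  | succ m =>
    rw [ladderPoly]
    push_cast
    rfl

/-- The effect of the shifts `s ↦ s ± ħ` on `t_m`. The first identity is the one expressing that
`actionShift` maps `t_m` to `t_{m+1}`; the second one is needed to carry the induction. -/
theorem ladderPoly_add_sub (ħ : ℝ) (m : ℕ) (s : ℂ) :
    (s + ħ / 2) * ladderPoly ħ m (s + ħ) + (s - ħ / 2) * ladderPoly ħ m (s - ħ)
        = ħ ^ 2 * m ^ 2 * ladderPoly ħ (m - 1) s + 2 * s * ladderPoly ħ m s ∧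
      (s + ħ / 2) * ladderPoly ħ m (s + ħ) - (s - ħ / 2) * ladderPoly ħ m (s - ħ)
        = ħ * (2 * m + 1) * ladderPoly ħ m s := by
  induction m using Nat.twoStepInduction with
  | zero =>
    simp only [ladderPoly]
    constructor <;> push_cast <;> ring
  | one =>
    simp only [ladderPoly, tsub_self]
    constructor <;> push_cast <;> ring
  | more m h0 h1 =>
    have e := ladderPoly_succ ħ m s
    rw [Nat.add_sub_cancel] at h1
    simp only [ladderPoly, show m + 2 - 1 = m + 1 from rfl]
    push_cast at h0 h1 ⊢
    obtain ⟨a0, b0⟩ := h0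
    obtain ⟨a1, b1⟩ := h1
    constructor
    · linear_combination s * a1 + ħ * b1 + ħ ^ 2 / 4 * (m + 1) ^ 2 * a0
        - ħ ^ 2 * (m + 1) ^ 2 * e
    · linear_combination s * b1 + ħ * a1 + ħ ^ 2 / 4 * (m + 1) ^ 2 * b0

/-- The product over the coordinates of the polynomials `t_{m_i}`, evaluated at the level `k`. It
gives the eigenvalues of the operator with Weyl symbol `∏ p_i ^ m_i`. -/
noncomputable def ladderProd (ħ : ℝ) (m k : Fin n → ℕ) : ℂ :=
  ∏ i, ladderPoly ħ (m i) (level ħ k i : ℝ)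

theorem ladderProd_add_single (ħ : ℝ) (m k : Fin n → ℕ) (j : Fin n) :
    ladderProd ħ (m + Pi.single j 1) k = (level ħ k j : ℝ) * ladderProd ħ m k
      + ħ ^ 2 / 4 * (m j) ^ 2 * ladderProd ħ (m - Pi.single j 1) k := by
  have e : ∀ m' : Fin n → ℕ, (∀ i, i ≠ j → m' i = m i) → ladderProd ħ m' k
      = ladderPoly ħ (m' j) (level ħ k j : ℝ)
        * ∏ i ∈ Finset.univ.erase j, ladderPoly ħ (m i) (level ħ k i : ℝ) := by
    intro m' hm
    rw [ladderProd, ← Finset.mul_prod_erase _ _ (Finset.mem_univ j)]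
    congr 1
    exact Finset.prod_congr rfl fun i hi => by rw [hm i (Finset.ne_of_mem_erase hi)]
  rw [e (m + Pi.single j 1) fun i hi => by simp [hi], e m fun _ _ => rfl,
    e (m - Pi.single j 1) fun i hi => by simp [hi]]
  simp only [Pi.add_apply, Pi.sub_apply, Pi.single_eq_same, ladderPoly_succ]
  ring

theorem actionShift_ladderProd (ħ : ℝ) (m : Fin n → ℕ) (j : Fin n) :
    actionShift ħ j (ladderProd ħ m) = ladderProd ħ (m + Pi.single j 1) := by
  ext k
  have e : ∀ m' k' : Fin n → ℕ, (∀ i, i ≠ j → m' i = m i ∧ k' i = k i) → ladderProd ħ m' k'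
      = ladderPoly ħ (m' j) (level ħ k' j : ℝ)
        * ∏ i ∈ Finset.univ.erase j, ladderPoly ħ (m i) (level ħ k i : ℝ) := by
    intro m' k' hm
    rw [ladderProd, ← Finset.mul_prod_erase _ _ (Finset.mem_univ j)]
    congr 1
    refine Finset.prod_congr rfl fun i hi => ?_
    obtain ⟨h1, h2⟩ := hm i (Finset.ne_of_mem_erase hi)
    rw [h1, level, level]
    simp only [h2]
  rw [actionShift, e m (k - Pi.single j 1) fun i hi => by simp [hi],
    e m (k + Pi.single j 1) fun i hi => by simp [hi],
    e (m + Pi.single j 1) k fun i hi => by simp [hi], e m k fun _ _ => ⟨rfl, rfl⟩]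
  have hl : ((level ħ k j : ℝ) : ℂ) = (k j + 1 / 2) * ħ := by
    simp [level]
  have hp : ((level ħ (k + Pi.single j 1) j : ℝ) : ℂ) = (k j + 1 / 2) * ħ + ħ := by
    simp [level]
    ring
  have hm : (k j : ℂ) * ladderPoly ħ (m j) (level ħ (k - Pi.single j 1) j : ℝ)
      = (k j : ℂ) * ladderPoly ħ (m j) ((k j + 1 / 2) * ħ - ħ) := by
    rcases Nat.eq_zero_or_pos (k j) with h0 | h0
    · simp [h0]
    · congr 2
      simp [level, Nat.cast_sub (Nat.one_le_of_lt h0)]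
      ring
  have hT := (ladderPoly_add_sub ħ (m j) ((k j + 1 / 2) * ħ)).1
  rw [hl, hp, ← mul_assoc (k j : ℂ), hm]
  simp only [Pi.add_apply, Pi.single_eq_same, ladderPoly_succ]
  linear_combination (1 / 4 * ∏ i ∈ Finset.univ.erase j, ladderPoly ħ (m i) (level ħ k i : ℝ)) * hT

theorem hasRadialSymbol_ladderProd (hħ : 0 < ħ) (m : Fin n → ℕ) :
    HasRadialSymbol hħ (ladderProd ħ m) := by
  induction m using multiIndex_induction with
  | h0 =>
    convert hasRadialSymbol_one (n := n) hħ using 2 with k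
    simp [ladderProd, ladderPoly]
  | hs m j h =>
    rw [← actionShift_ladderProd]
    exact (h m le_rfl).actionShift j

/-- The factor `ladderProd ħ m` makes the induction on `q` work: a variable of `q` is absorbed into
it by the three-term recursion `ladderProd_add_single`. -/
theorem hasRadialSymbol_eval_mul_ladderProd (hħ : 0 < ħ) (q : MvPolynomial (Fin n) ℂ) :
    ∀ m, HasRadialSymbol hħ
      fun k => MvPolynomial.eval (fun i => ((level ħ k i : ℝ) : ℂ)) q * ladderProd ħ m k := by
  induction q using MvPolynomial.induction_on with
  | C r =>
    intro m
    simpa using (hasRadialSymbol_ladderProd hħ m).const_mul r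
  | add p q hp hq =>
    intro m
    simpa [add_mul] using (hp m).add (hq m)
  | mul_X p j hp =>
    intro m
    have h := (hp (m + Pi.single j 1)).add
      ((hp (m - Pi.single j 1)).const_mul (-(ħ ^ 2 / 4 * (m j) ^ 2)))
    convert h using 2 with k
    rw [ladderProd_add_single, map_mul, MvPolynomial.eval_X]
    ring

theorem hasRadialSymbol_eval (hħ : 0 < ħ) (q : MvPolynomial (Fin n) ℂ) :
    HasRadialSymbol hħ fun k => MvPolynomial.eval (fun i => ((level ħ k i : ℝ) : ℂ)) q := by
  convert hasRadialSymbol_eval_mul_ladderProd hħ q 0 using 2 with k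
  simp [ladderProd, ladderPoly]

/-! ### Rapidly decreasing functions of the oscillators -/

theorem action_mul_wigner_hermite (hħ : 0 < ħ) (k : Fin n → ℕ) (j : Fin n)
    (z : Space n × Space n) :
    ((action z j : ℝ) : ℂ) * wigner ħ (hermite ħ hħ k) (hermite ħ hħ k) z
      = (level ħ k j : ℝ) * wigner ħ (hermite ħ hħ k) (hermite ħ hħ k) z / 2
        + ħ * (k j * wigner ħ (hermite ħ hħ (k - Pi.single j 1))
            (hermite ħ hħ (k - Pi.single j 1)) z
          + (k j + 1) * wigner ħ (hermite ħ hħ (k + Pi.single j 1))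
            (hermite ħ hħ (k + Pi.single j 1)) z) / 4 := by
  have hl : wigner ħ (lowering ħ j (hermite ħ hħ k)) (lowering ħ j (hermite ħ hħ k)) z
      = 2 * ħ * k j * wigner ħ (hermite ħ hħ (k - Pi.single j 1))
        (hermite ħ hħ (k - Pi.single j 1)) z := by
    by_cases hk : k j = 0
    · rw [lowering_hermite_of_eq_zero ħ hħ hk, wigner_zero_left, hk]
      simp
    · set l : Fin n → ℕ := k - Pi.single j 1 with hl
      have hkl : k = l + Pi.single j 1 := (sub_single_add_single hk).symm
      rw [hkl, lowering_hermite_add, wigner_smul_left, wigner_smul_right, Complex.conj_ofReal,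
        ← mul_assoc, sq_ladder_factor hħ]
      simp
  rw [action_mul_wigner hħ, hl, raising_hermite, wigner_smul_left, wigner_smul_right,
    oscillator_hermite, wigner_smul_left, wigner_smul_right, Complex.conj_ofReal,
    Complex.conj_ofReal, ← mul_assoc ((√(2 * ħ * (k j + 1)) : ℝ) : ℂ), sq_ladder_factor hħ]
  ring

/-- The Wigner functions of the Hermite functions depend on the classical oscillators only: the
recursion `action_mul_wigner_hermite` expresses `W(φ_{k+e_j}, φ_{k+e_j})` by `p_j` and the Wigner
functions for `k` and `k - e_j`. -/
theorem factorsThrough_wigner_hermite (hħ : 0 < ħ) (k : Fin n → ℕ) :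
    Function.FactorsThrough (wigner ħ (hermite ħ hħ k) (hermite ħ hħ k)) action := by
  induction k using multiIndex_induction with
  | h0 =>
    intro z w hzw
    obtain ⟨K, -, hK⟩ := exists_wigner_gaussian_eq (n := n) hħ
    rw [hermite, hermiteRaw_zero, wigner_smul_left, wigner_smul_right, wigner_smul_left,
      wigner_smul_right, hK, hK, hzw]
  | hs k j h =>
    intro z w hzw
    have hz := action_mul_wigner_hermite hħ k j z
    have hw := action_mul_wigner_hermite hħ k j w
    have hle : ∑ i, (k - Pi.single j 1 : Fin n → ℕ) i ≤ ∑ i, k i :=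
      Finset.sum_le_sum fun i _ => by simp
    rw [h k le_rfl hzw, h _ hle hzw, hzw] at hz
    have h1 : ((k j : ℂ) + 1) ≠ 0 := Nat.cast_add_one_ne_zero _
    have h2 : (ħ : ℂ) ≠ 0 := Complex.ofReal_ne_zero.mpr hħ.ne'
    refine mul_left_cancel₀ (mul_ne_zero h2 h1) ?_
    linear_combination 4 * hw - 4 * hz

/-- The symbol is the series of the symbols `(2πħ)ⁿ W(φ_k, φ_k)` of the projections onto the
Hermite functions. -/
theorem hasRadialSymbol_of_summable (hħ : 0 < ħ) {c : (Fin n → ℕ) → ℂ}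
    (hc : Summable fun k => ‖c k‖) : HasRadialSymbol hħ c := by
  have hpos : 0 < 2 * Real.pi * ħ := by positivity
  set w : (Fin n → ℕ) → Space n × Space n → ℂ := fun k z =>
    ((2 * Real.pi * ħ : ℝ) : ℂ) ^ n * wigner ħ (hermite ħ hħ k) (hermite ħ hħ k) z with hw
  have hwc : ∀ k, Continuous (w k) := fun k => continuous_const.mul (continuous_wigner ħ _ _)
  have hwb : ∀ k z, ‖w k z‖ ≤ 2 ^ n := by
    intro k z
    have h1 := norm_wigner_le hħ (hermite ħ hħ k) (hermite ħ hħ k) z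
    rw [(orthonormal_hermite ħ hħ).1 k] at h1
    rw [hw, norm_mul, norm_pow, Complex.norm_real, Real.norm_of_nonneg hpos.le]
    calc (2 * Real.pi * ħ) ^ n * ‖wigner ħ (hermite ħ hħ k) (hermite ħ hħ k) z‖
        ≤ (2 * Real.pi * ħ) ^ n *
          ((2 * Real.pi * ħ)⁻¹ ^ n * (2 ^ n * ((1 ^ 2 + 1 ^ 2) / 2))) := by gcongr
      _ = 2 ^ n := by
        rw [← mul_assoc, ← mul_pow, mul_inv_cancel₀ hpos.ne']
        norm_num
  have hb : ∀ k z, ‖c k * w k z‖ ≤ ‖c k‖ * 2 ^ n := fun k z => by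
    rw [norm_mul]
    exact mul_le_mul_of_nonneg_left (hwb k z) (norm_nonneg _)
  have hs := hc.mul_right (2 ^ n)
  refine ⟨fun z => ∑' k, c k * w k z, ⟨⟨continuous_tsum (fun k => continuous_const.mul (hwc k))
    hs hb, ∑' k, ‖c k‖ * 2 ^ n, 0, fun z => ?_⟩, fun u v => ?_⟩, fun z z' h => ?_⟩
  · rw [pow_zero, mul_one]
    exact tsum_of_norm_bounded hs.hasSum fun k => hb k z
  · have hW : Integrable (wigner ħ u v) := by
      simpa using (isAdmissible_const 1).integrable_mul_wigner hħ u v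
    have hle : ∀ k z, ‖c k * w k z * wigner ħ u v z‖ ≤ ‖c k‖ * 2 ^ n * ‖wigner ħ u v z‖ :=
      fun k z => by
        rw [norm_mul]
        exact mul_le_mul_of_nonneg_right (hb k z) (norm_nonneg _)
    have hi : ∀ k, Integrable fun z => c k * w k z * wigner ħ u v z := fun k =>
      (hW.norm.const_mul (‖c k‖ * 2 ^ n)).mono'
        ((continuous_const.mul (hwc k)).mul (continuous_wigner ħ u v)).aestronglyMeasurable
        (Filter.Eventually.of_forall (hle k))
    have h := hasSum_integral_of_summable_integral_norm hi
      (Summable.of_nonneg_of_le (fun k => integral_nonneg fun z => norm_nonneg _)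
        (fun k => integral_mono (hi k).norm (hW.norm.const_mul _) (hle k)) (by
          simp only [integral_const_mul]
          exact hs.mul_right _))
    simp only [tsum_mul_right] at h
    refine hasSum_of_eq h fun k => ?_
    simp only [mul_assoc (c k), integral_const_mul, hw]
    rw [integral_wigner_mul_wigner hħ]
    rfl
  · simp only [hw, factorsThrough_wigner_hermite hħ _ h]

theorem summable_prod_apply {g : ℕ → ℝ} (hg0 : ∀ m, 0 ≤ g m) (hg : Summable g) :
    ∀ n : ℕ, Summable fun k : Fin n → ℕ => ∏ i, g (k i)
  | 0 => Summable.of_finite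
  | n + 1 => by
    rw [← (Fin.consEquiv fun _ => ℕ).summable_iff]
    refine (Summable.mul_of_nonneg hg (summable_prod_apply hg0 hg n) hg0
      fun k => Finset.prod_nonneg fun i _ => hg0 _).congr fun p => ?_
    simp [Fin.prod_univ_succ, Fin.consEquiv]

/-- A Schwartz function is summable over the joint spectrum of the oscillators: its decay of order
`2n` dominates a product of one-variable inverse squares. -/
theorem summable_schwartz_level (hħ : 0 < ħ) (f : 𝓢(Space n, ℂ)) :
    Summable fun k : Fin n → ℕ => ‖f (level ħ k)‖ := by
  obtain ⟨C, hC⟩ : ∃ C, ∀ x : Space n, (1 + ‖x‖) ^ (2 * n) * ‖f x‖ ≤ C :=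
    ⟨_, fun x => by
      simpa using SchwartzMap.one_add_le_sup_seminorm_apply (𝕜 := ℝ) (m := (2 * n, 0))
        le_rfl le_rfl f x⟩
  set g : ℕ → ℝ := fun m => ((1 + (m + 1 / 2) * ħ) ^ 2)⁻¹ with hg
  have hgs : Summable g := by
    have h1 : Summable fun m : ℕ => (ħ ^ 2)⁻¹ * (1 / |(m : ℝ) + (1 / ħ + 1 / 2)| ^ (2 : ℝ)) :=
      ((Real.summable_one_div_nat_add_rpow (1 / ħ + 1 / 2) 2).mpr one_lt_two).mul_left _
    refine h1.congr fun m => ?_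
    have h2 : 0 ≤ (m : ℝ) + (1 / ħ + 1 / 2) := by positivity
    rw [abs_of_nonneg h2, Real.rpow_two, hg, one_div, ← mul_inv, ← mul_pow]
    congr 2
    field_simp
    ring
  have hC0 : 0 ≤ C := le_trans (by positivity) (hC 0)
  refine Summable.of_nonneg_of_le (fun k => norm_nonneg _) (fun k => ?_)
    ((summable_prod_apply (fun m => by positivity) hgs n).mul_left C)
  have h1 : ∏ i, (1 + ((k i : ℝ) + 1 / 2) * ħ) ^ 2 ≤ (1 + ‖level ħ k‖) ^ (2 * n) := by
    rw [Finset.prod_pow, mul_comm 2 n, pow_mul]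
    refine pow_le_pow_left₀ (Finset.prod_nonneg fun i _ => by positivity) ?_ 2
    refine (Finset.prod_le_prod (g := fun _ => 1 + ‖level ħ k‖) (fun i _ => by positivity)
      fun i _ => ?_).trans (by simp)
    have h2 := PiLp.norm_apply_le (level ħ k) i
    have h3 : level ħ k i = ((k i : ℝ) + 1 / 2) * ħ := rfl
    rw [h3, Real.norm_of_nonneg (by positivity)] at h2
    linarith
  have h4 : 0 < ∏ i, (1 + ((k i : ℝ) + 1 / 2) * ħ) ^ 2 :=
    Finset.prod_pos fun i _ => by positivity
  simp only [hg, Finset.prod_inv_distrib]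
  rw [← div_eq_mul_inv, le_div_iff₀ h4, mul_comm]
  exact (mul_le_mul_of_nonneg_right h1 (norm_nonneg _)).trans (hC _)

/-! ### Weyl symbols of functions of the oscillators -/

theorem IsSchwartzOrPolynomial.measurable {h : Space n → ℂ} (hh : IsSchwartzOrPolynomial h) :
    Measurable h := by
  rcases hh with ⟨f, hf⟩ | ⟨q, hq⟩
  · rw [funext hf]
    exact f.continuous.measurable
  · rw [funext hq]
    clear hq
    induction q using MvPolynomial.induction_on with
    | C r => simp
    | add p q hp hq =>
      simp only [map_add]
      exact hp.add hq
    | mul_X p j hp =>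
      simp only [map_mul, MvPolynomial.eval_X]
      exact hp.mul (measurable_coord j)

theorem IsSchwartzOrPolynomial.hasRadialSymbol (hħ : 0 < ħ) {h : Space n → ℂ}
    (hh : IsSchwartzOrPolynomial h) : HasRadialSymbol hħ fun k => h (level ħ k) := by
  rcases hh with ⟨f, hf⟩ | ⟨q, hq⟩
  · simp only [hf]
    exact hasRadialSymbol_of_summable hħ (summable_schwartz_level hħ f)
  · simp only [hq]
    exact hasRadialSymbol_eval hħ q

/-- The polynomial `q(P)` maps Schwartz functions to Schwartz functions. -/
theorem exists_schwartz_ip_hermite (hħ : 0 < ħ) (q : MvPolynomial (Fin n) ℂ) :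
    ∀ u : 𝓢(Space n, ℂ), ∃ f : 𝓢(Space n, ℂ), ∀ k, ip (hermite ħ hħ k) f
      = MvPolynomial.eval (fun i => ((level ħ k i : ℝ) : ℂ)) q * ip (hermite ħ hħ k) u := by
  induction q using MvPolynomial.induction_on with
  | C r => exact fun u => ⟨r • u, fun k => by rw [ip_smul_right, MvPolynomial.eval_C]⟩
  | add p q hp hq =>
    intro u
    obtain ⟨f, hf⟩ := hp u
    obtain ⟨g, hg⟩ := hq u
    exact ⟨f + g, fun k => by rw [ip_add_right, hf, hg, map_add, add_mul]⟩
  | mul_X p j hp =>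
    intro u
    obtain ⟨f, hf⟩ := hp (oscillator ħ j u)
    refine ⟨f, fun k => ?_⟩
    rw [hf, ← ip_oscillator, oscillator_hermite, ip_smul_left, Complex.conj_ofReal, map_mul,
      MvPolynomial.eval_X, mul_assoc]

/-- Bounded diagonal operators exist. -/
theorem exists_inner_eq_mul {ι H : Type*} [NormedAddCommGroup H] [InnerProductSpace ℂ H]
    [CompleteSpace H] (b : HilbertBasis ι ℂ H) {d : ι → ℂ} {C : ℝ} (hd : ∀ k, ‖d k‖ ≤ C) (x : H) :
    ∃ y, ∀ k, inner ℂ (b k) y = d k * inner ℂ (b k) x := by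
  have hm : Memℓp (fun k => d k * b.repr x k) 2 :=
    ((lp.memℓp (b.repr x)).norm.const_mul C).mono fun k => by
      rw [norm_mul]
      exact mul_le_mul_of_nonneg_right (hd k) (norm_nonneg _)
  refine ⟨b.repr.symm ⟨_, hm⟩, fun k => ?_⟩
  rw [← b.repr_apply_apply, LinearIsometryEquiv.apply_symm_apply, ← b.repr_apply_apply]

/-- Schwartz functions belong to the domain of `h(P)`. -/
theorem IsSchwartzOrPolynomial.exists_inner_hermite (hħ : 0 < ħ) {h : Space n → ℂ}
    (hh : IsSchwartzOrPolynomial h) (u : 𝓢(Space n, ℂ)) : ∃ f : L2 n, ∀ k,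
      inner ℂ (hermiteBasis n ħ hħ k) f
        = h (level ħ k) * inner ℂ (hermiteBasis n ħ hħ k) (u.toLp 2) := by
  rcases hh with ⟨g, hg⟩ | ⟨q, hq⟩
  · obtain ⟨C, -, hC⟩ := g.decay 0 0
    refine exists_inner_eq_mul (hermiteBasis n ħ hħ) (C := C) (fun k => ?_) _
    simpa [hg] using hC (level ħ k)
  · obtain ⟨f, hf⟩ := exists_schwartz_ip_hermite hħ q u
    refine ⟨f.toLp 2, fun k => ?_⟩
    rw [hermiteBasis_apply, hq]
    exact hf k

theorem isWeylSymbol_iff (hħ : 0 < ħ) {h : Space n → ℂ} (hh : IsSchwartzOrPolynomial h)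
    (a : Space n × Space n → ℂ) : IsWeylSymbol ħ a (FunctionOfOscillators ħ h)
      ↔ HasDiagonalSymbol hħ (fun k => h (level ħ k)) a := by
  have key : ∀ (u v : 𝓢(Space n, ℂ)) (f : L2 n), (∀ k, inner ℂ (hermiteBasis n ħ hħ k) f
        = h (level ħ k) * inner ℂ (hermiteBasis n ħ hħ k) (u.toLp 2)) →
      HasSum (fun k => h (level ħ k) * hermiteCoeff hħ u v k) (inner ℂ (v.toLp 2) f) := by
    intro u v f hf
    refine hasSum_of_eq ((hermiteBasis n ħ hħ).hasSum_inner_mul_inner (v.toLp 2) f) fun k => ?_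
    rw [hf, hermiteBasis_apply, hermiteCoeff, ip, ip]
    ring
  constructor
  · rintro ⟨hc, hg, hs⟩
    refine ⟨⟨hc, hg⟩, fun u v => ?_⟩
    obtain ⟨f, hf, hv⟩ := hs u
    rw [← hv v]
    exact key u v f ((functionOfOscillators_iff hħ hh.measurable _ _).mp hf)
  · rintro ⟨⟨hc, hg⟩, hs⟩
    refine ⟨hc, hg, fun u => ?_⟩
    obtain ⟨f, hf⟩ := hh.exists_inner_hermite hħ u
    exact ⟨f, (functionOfOscillators_iff hħ hh.measurable _ _).mpr hf, fun v =>
      (key u v f hf).unique (hs u v)⟩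

end WeylOscillator

/-- There is a map `F` such that, for every `h` in the Schwartz class or polynomial, the operator
`h(P_1, …, P_n)` has exactly one Weyl symbol, which is the function
`h^{we}(p_1, …, p_n)` of the classical oscillators with `h^{we} = F ((h ((k + 1/2) ħ))_k)`. -/
theorem corollary5 (n : ℕ) (ħ : ℝ) (hħ : 0 < ħ) :
    ∃ F : ((Fin n → ℕ) → ℂ) → (Fin n → ℝ≥0) → ℂ,
      ∀ h : WeylOscillator.Space n → ℂ, WeylOscillator.IsSchwartzOrPolynomial h →
        ∀ a : WeylOscillator.Space n × WeylOscillator.Space n → ℂ,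
          WeylOscillator.IsWeylSymbol ħ a (WeylOscillator.FunctionOfOscillators ħ h) ↔
            a = fun z => F (fun k => h (WeylOscillator.level ħ k)) (WeylOscillator.action z) := by
  -- `F c` is the radial profile of the symbol with eigenvalues `c`, an arbitrary value if none
  -- exists.
  refine ⟨fun c => Classical.epsilon fun g : (Fin n → ℝ≥0) → ℂ =>
    WeylOscillator.HasDiagonalSymbol hħ c fun z => g (WeylOscillator.action z), fun h hh a => ?_⟩
  rw [WeylOscillator.isWeylSymbol_iff hħ hh]
  have hF := Classical.epsilon_spec (p := fun g : (Fin n → ℝ≥0) → ℂ =>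
    WeylOscillator.HasDiagonalSymbol hħ (fun k => h (WeylOscillator.level ħ k))
      fun z => g (WeylOscillator.action z)) (by
    obtain ⟨b, hb, hr⟩ := hh.hasRadialSymbol hħ
    obtain ⟨g, rfl⟩ := (Function.factorsThrough_iff b).mp hr
    exact ⟨g, hb⟩)
  exact ⟨fun ha => ha.unique hF, fun ha => ha ▸ hF⟩
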